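/- **Setting.** A CAMDP with finite state set of size $S$ and action set of size $A$ consists of transition laws $P(\cdot\mid s,a)$, a reward $r$ and a constraint reward $c$ with values in $[0,1]$, a threshold $b\in\mathbb R$ and an initial state distribution. For a stationary (stochastic) policy $\pi$ let $\rho_f^\pi=\lim_{T\to\infty}\frac1T\mathbb E^\pi[\sum_{t<T}f(s_t,a_t)]$ for $f\in\{r,c\}$, started from the initial distribution, and let $h_f^\pi$ be the corresponding bias function (Cesàro limit of $\mathbb E_s^\pi[\sum_{t<T}(f(s_t,a_t)-\rho_f^\pi(s_t))]$, where $\rho_f^\pi(s)$ is the average started from $s$). Let $\rho_r^*=\sup\{\rho_r^\pi:\rho_c^\pi\ge b\}$. A policy $\pi$ is $\eta$-optimal (strict feasibility) if $\rho_r^\pi\ge\rho_r^*-\eta$ and $\rho_c^\pi\ge b$. The Slater constant is $\sup_\pi\rho_c^\pi-b$; the diameter is $\max_{s\ne s'}\min_\pi\mathbb E_s^\pi[\tau_{s'}]$ with $\tau_{s'}$ the hitting time of $s'$; $H$ is the maximal span $\max_s h(s)-\min_s h(s)$ of the bias functions $h_r^\pi,h_c^\pi$ over stationary deterministic policies $\pi$.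 The CAMDP is communicating if for any two states $s,s'$ some stationary policy makes $s'$ reachable from $s$. An algorithm knows $r,c,b$ and the initial distribution, draws samples from $P(\cdot\mid s,a)$ at adaptively (possibly randomly) chosen pairs $(s,a)$, and, upon stopping, returns a stationary policy, which may be random. **Theorem (lower bound for communicating CAMDPs).** There are universal constants $\varepsilon_0,\kappa>0$, $c_1,c_2\ge0$ and $S_0,A_0\in\mathbb N$ such that the following holds for all $S\ge S_0$, $A\ge A_0$, $0<\varepsilon\le\varepsilon_0$, $0<\zeta\le1$ and $D\ge\max\{c_1S,c_2\}$. Let $\mathcal M$ be the class of communicating CAMDPs with $S$ states, $A$ actions, diameter at most $D$ and Slater constant $\zeta$. For every algorithm that on each CAMDP in $\mathcal M$ returns an $\frac{\varepsilon}{24}$-optimal policy with probability at least $\frac34$ (in particular, for every algorithm that does so on all communicating CAMDPs with positive Slater constant), there is a CAMDP in $\mathcal M$ on which the expected total number of samples over all state-action pairs drawn by the algorithm is at least $$\kappa\,\frac{SAD}{\varepsilon^2\zeta^2}\qquad\text{and also at least}\qquad \kappa\,\frac{SAH}{\varepsilon^2\zeta^2},$$ where $H$ is the span bound of that CAMDP;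 in particular it is $\tilde\Omega\!\left(\frac{SAD}{\varepsilon^2\zeta^2}\right)$ and $\tilde\Omega\!\left(\frac{SAH}{\varepsilon^2\zeta^2}\right)$. -/

import Mathlib

open Filter Topology
open scoped ENNReal Matrix

noncomputable section

namespace AvgCMDP

/-- Stationary stochastic policies: a probability vector over actions for every state. -/
abbrev Policy (S A : Type) [Fintype A] : Type := S → stdSimplex ℝ A

/-- The policy which plays the action `d s` in state `s`. -/
def Policy.ofDet {S A : Type} [Fintype A] [DecidableEq A] (d : S → A) : Policy S A :=
  fun s => ⟨Pi.single (d s) 1, single_mem_stdSimplex ℝ (d s)⟩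

/-- The part of a constrained average-reward MDP which is known to the learner: reward `r` and
constraint reward `c`, both with values in `[0,1]`, the constraint threshold `b` and the initial
state distribution `init`. -/
structure Task (S A : Type) [Fintype S] where
  r : S → A → ℝ
  c : S → A → ℝ
  b : ℝ
  init : stdSimplex ℝ S
  r_mem : ∀ s a, r s a ∈ Set.Icc (0 : ℝ) 1
  c_mem : ∀ s a, c s a ∈ Set.Icc (0 : ℝ) 1

/-- A finite constrained average-reward MDP: `P s a` is the law of the next state when the action
`a` is played in the state `s`. -/
structure CAMDP (S A : Type) [Fintype S] extends Task S A where
  P : S → A → stdSimplex ℝ S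

namespace CAMDP

variable {S A : Type} [Fintype S] [DecidableEq S] [Fintype A]

/-- Transition matrix of the Markov chain induced by the policy `π`. -/
def chain (M : CAMDP S A) (π : Policy S A) : Matrix S S ℝ :=
  fun s s' => ∑ a, (π s).1 a * (M.P s a).1 s'

/-- `E_s^π[f(s_t, a_t)]`, for the chain started in `s`. -/
def expectAt (M : CAMDP S A) (f : S → A → ℝ) (π : Policy S A) (t : ℕ) (s : S) : ℝ :=
  ((M.chain π ^ t) *ᵥ fun s' => ∑ a, (π s').1 a * f s' a) s

/-- `ρ_f^π(s) = lim_T (1/T) E_s^π[∑_{t<T} f(s_t, a_t)]`; the limit exists as `S` is finite. -/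
def gainAt (M : CAMDP S A) (f : S → A → ℝ) (π : Policy S A) (s : S) : ℝ :=
  limUnder atTop fun T : ℕ => (T : ℝ)⁻¹ * ∑ t ∈ Finset.range T, M.expectAt f π t s

/-- Average of `f` under `π` when the initial state has the law `M.init`. -/
def gain (M : CAMDP S A) (f : S → A → ℝ) (π : Policy S A) : ℝ :=
  ∑ s, M.init.1 s * M.gainAt f π s

/-- Bias function `h_f^π(s)`: the Cesàro limit, as `T → ∞`, of
`E_s^π[∑_{t<T} (f(s_t, a_t) - ρ_f^π(s_t))]`; it exists as `S` is finite. -/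
def bias (M : CAMDP S A) (f : S → A → ℝ) (π : Policy S A) (s : S) : ℝ :=
  limUnder atTop fun N : ℕ => (N : ℝ)⁻¹ * ∑ T ∈ Finset.Icc 1 N,
    ∑ t ∈ Finset.range T, M.expectAt (fun s' a => f s' a - M.gainAt f π s') π t s

/-- Every state can be reached from every state under some stationary policy. -/
def IsCommunicating (M : CAMDP S A) : Prop :=
  ∀ s s' : S, ∃ π : Policy S A, ∃ n : ℕ, 0 < (M.chain π ^ n) s s'

/-- `P_s^π(τ_g > n)`, where `τ_g = inf {t ≥ 0 | s_t = g}`. -/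
def avoidProb (M : CAMDP S A) (π : Policy S A) (g : S) : ℕ → S → ℝ
  | 0, s => if s = g then 0 else 1
  | n + 1, s => if s = g then 0 else ∑ s', M.chain π s s' * M.avoidProb π g n s'

/-- `E_s^π[τ_g] = ∑_n P_s^π(τ_g > n)`, possibly infinite. -/
def hittingTime (M : CAMDP S A) (π : Policy S A) (g s : S) : ℝ≥0∞ :=
  ∑' n : ℕ, ENNReal.ofReal (M.avoidProb π g n s)

/-- The diameter `max_{s ≠ g} min_π E_s^π[τ_g]`. -/
def diameter (M : CAMDP S A) : ℝ≥0∞ :=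
  ⨆ (s : S) (g : S) (_ : s ≠ g), ⨅ π : Policy S A, M.hittingTime π g s

/-- The Slater constant `max_π ρ_c^π - b`. -/
def slater (M : CAMDP S A) : ℝ := (⨆ π : Policy S A, M.gain M.c π) - M.b

/-- The optimal value of `max_π ρ_r^π` subject to `ρ_c^π ≥ b`. -/
def optValue (M : CAMDP S A) : ℝ :=
  sSup {x | ∃ π : Policy S A, M.b ≤ M.gain M.c π ∧ x = M.gain M.r π}

/-- `η`-optimality under strict feasibility: the constraint holds exactly, and the average reward
is within `η` of the optimal value. -/
def IsNearOptimal (M : CAMDP S A) (η : ℝ) (π : Policy S A) : Prop :=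
  M.optValue - η ≤ M.gain M.r π ∧ M.b ≤ M.gain M.c π

/-- The span seminorm `max v - min v`. -/
def spanNorm (v : S → ℝ) : ℝ := (⨆ s, v s) - ⨅ s, v s

/-- The span bound `H`: the largest span of a reward or constraint bias function of a stationary
deterministic policy. -/
def biasSpan [DecidableEq A] (M : CAMDP S A) : ℝ :=
  max (⨆ d : S → A, spanNorm (M.bias M.r (Policy.ofDet d)))
    (⨆ d : S → A, spanNorm (M.bias M.c (Policy.ofDet d)))

end CAMDP

/-- A randomized adaptive sampling procedure with access to a generative model. A history lists
the samples `(s, a, s')` drawn so far, newest first. Given the history, `next` is the law of the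
next move: `some (s, a)` asks for a fresh sample of the next state at `(s, a)`, and `none` stops;
`output` is the law of the policy returned upon stopping. -/
structure Sampler (S A : Type) [Fintype A] where
  next : List (S × A × S) → PMF (Option (S × A))
  output : List (S × A × S) → MeasureTheory.ProbabilityMeasure (Policy S A)

namespace Sampler

variable {S A : Type} [Fintype S] [Fintype A]

/-- The probability that the first samples drawn are exactly those of the given history, when the
generative model has the transition law `P`. -/
def reachProb (L : Sampler S A) (P : S → A → stdSimplex ℝ S) : List (S × A × S) → ℝ≥0∞
  | [] => 1
  | (s, a, s') :: h =>
      L.reachProb P h * L.next h (some (s, a)) * ENNReal.ofReal ((P s a).1 s')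

/-- The probability that the procedure stops and returns a policy in `G`. -/
def returnProb (L : Sampler S A) (P : S → A → stdSimplex ℝ S) (G : Set (Policy S A)) : ℝ≥0∞ :=
  ∑' h : List (S × A × S),
    L.reachProb P h * L.next h none * (L.output h : MeasureTheory.Measure (Policy S A)) G

/-- The expected total number of samples drawn, over all state-action pairs: the sum, over all
histories and all pairs, of the probability that this history occurs and this pair is sampled
next. It is infinite if the procedure fails to stop with positive probability. -/
def expectedSamples (L : Sampler S A) (P : S → A → stdSimplex ℝ S) : ℝ≥0∞ :=
  ∑ s : S, ∑ a : A, ∑' h : List (S × A × S), L.reachProb P h * L.next h (some (s, a))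

end Sampler

/-- A learning algorithm: the rewards, the threshold and the initial distribution are known to it,
the transition law is accessible through samples only. -/
abbrev Algorithm (S A : Type) [Fintype S] [Fintype A] : Type := Task S A → Sampler S A

/-- The class of communicating CAMDPs with diameter at most `D` and Slater constant `ζ`. -/
def InClass {S A : Type} [Fintype S] [DecidableEq S] [Fintype A] (D ζ : ℝ) (M : CAMDP S A) :
    Prop :=
  M.IsCommunicating ∧ M.diameter ≤ ENNReal.ofReal D ∧ M.slater = ζ

end AvgCMDP

end

/-! The hard instances share one known task and differ at a single state-action pair. State `y` is
left with probability p for a uniform state of the pool (all other states); in the pool, `a₀`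
redraws the state uniformly and any other action moves to `y` with probability p. The instance
perturbed at (i, a) has p(1+δ) there. Let H and R be the fractions of time spent in the pool off and
on `a₀`, and X the fraction spent on (i, a). Flow balance at `y` gives 2H + δX + R = 1
(`exists_balance`, `exists_frequencies`).

Take p = 4/D and δ = 16εζ. For ζ ≤ 1/4 the average reward is 1 − R and feasibility reads δX/2 + 2ζR
≥ ζ. Time on the pair thus buys relief from `a₀` at rate δ/(4ζ) = 4ε: a perturbation of size εζ
moves the optimal value by order ε, which is the source of the factor ζ⁻². For ζ > 1/4 the
constraint is void and the average reward is 1/2 + δX/2. In both regimes a near-optimal policy must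
put well over half of H on (i, a) (`concentrated_of_small`, `concentrated_of_large`), and no policy
does so for two pairs (`disjoint_concentrated`).

Telling the perturbed law from the unperturbed one takes about 1/(pδ²), that is D/(ε²ζ²), samples at
the pair. Hence success on the perturbed instance forces, on the unperturbed one, either a
nonnegligible chance of returning a policy concentrated on that pair or that many samples there
(`le_returnProb_add_expectedVisits`). By disjointness those chances sum to at most one, so summing
over the (S−1)(A−1) pairs gives the bound (`le_expectedSamples_of_disjoint`). The unperturbed
instance has bias span at most 2D, so the second bound follows from the first. -/

namespace AvgCMDP

/-! ### Mean ergodic theorem for finite stochastic matrices. -/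

section Cesaro

variable {S : Type} [Fintype S] [DecidableEq S] {P : Matrix S S ℝ}

lemma abs_mulVec_le (hP : P ∈ Matrix.rowStochastic ℝ S) {v : S → ℝ} {B : ℝ}
    (hv : ∀ s, |v s| ≤ B) (s : S) : |(P *ᵥ v) s| ≤ B := by
  calc |∑ s', P s s' * v s'| ≤ ∑ s', |P s s' * v s'| := Finset.abs_sum_le_sum_abs _ _
    _ ≤ ∑ s', P s s' * B := by
        refine Finset.sum_le_sum fun s' _ => ?_
        rw [abs_mul, abs_of_nonneg (Matrix.nonneg_of_mem_rowStochastic hP)]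
        exact mul_le_mul_of_nonneg_left (hv s') (Matrix.nonneg_of_mem_rowStochastic hP)
    _ = B := by rw [← Finset.sum_mul, Matrix.sum_row_of_mem_rowStochastic hP, one_mul]

lemma abs_pow_mulVec_le (hP : P ∈ Matrix.rowStochastic ℝ S) {v : S → ℝ} {B : ℝ}
    (hv : ∀ s, |v s| ≤ B) (t : ℕ) (s : S) : |((P ^ t) *ᵥ v) s| ≤ B :=
  abs_mulVec_le (pow_mem hP t) hv s

lemma tendsto_inv_mul_of_bounded {a : ℕ → ℝ} {B : ℝ} (ha : ∀ T, |a T| ≤ B) :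
    Tendsto (fun T : ℕ => (T : ℝ)⁻¹ * a T) atTop (𝓝 0) := by
  refine (tendsto_inv_atTop_nhds_zero_nat (𝕜 := ℝ)).zero_mul_isBoundedUnder_le ?_
  exact isBoundedUnder_of ⟨B, fun T => by simpa using ha T⟩

lemma sum_pow_mulVec_sub (P : Matrix S S ℝ) (w : S → ℝ) (T : ℕ) :
    ∑ t ∈ Finset.range T, (P ^ t) *ᵥ (w - P *ᵥ w) = w - (P ^ T) *ᵥ w := by
  induction T with
  | zero => simp
  | succ T ih =>
    rw [Finset.sum_range_succ, ih, Matrix.mulVec_sub, Matrix.mulVec_mulVec, ← pow_succ]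
    abel

lemma sum_pow_mulVec_sub_apply (P : Matrix S S ℝ) (w : S → ℝ) (T : ℕ) (s : S) :
    ∑ t ∈ Finset.range T, ((P ^ t) *ᵥ (w - P *ᵥ w)) s = w s - ((P ^ T) *ᵥ w) s := by
  have := congrFun (sum_pow_mulVec_sub P w T) s
  simpa using this

omit [DecidableEq S] in
lemma exists_abs_le (w : S → ℝ) : ∃ B, ∀ s, |w s| ≤ B :=
  ⟨∑ s, |w s|, fun s => Finset.single_le_sum (f := fun s => |w s|)
    (fun _ _ => abs_nonneg _) (Finset.mem_univ s)⟩

lemma tendsto_cesaro_sub (hP : P ∈ Matrix.rowStochastic ℝ S) (w : S → ℝ) (s : S) :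
    Tendsto (fun T : ℕ => (T : ℝ)⁻¹ * ∑ t ∈ Finset.range T, ((P ^ t) *ᵥ (w - P *ᵥ w)) s)
      atTop (𝓝 0) := by
  obtain ⟨B, hB⟩ := exists_abs_le w
  simp only [sum_pow_mulVec_sub_apply]
  refine tendsto_inv_mul_of_bounded (B := B + B) fun T => ?_
  exact (abs_sub _ _).trans (add_le_add (hB s) (abs_pow_mulVec_le hP hB T s))

lemma pow_mulVec_of_fixed {u : S → ℝ} (hu : P *ᵥ u = u) (t : ℕ) : (P ^ t) *ᵥ u = u := by
  induction t with
  | zero => simp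
  | succ t ih => rw [pow_succ, ← Matrix.mulVec_mulVec, hu, ih]

/-- Every vector is the sum of a fixed vector and a coboundary. -/
lemma exists_fixed_add_coboundary (hP : P ∈ Matrix.rowStochastic ℝ S) (v : S → ℝ) :
    ∃ u w : S → ℝ, P *ᵥ u = u ∧ v = u + (w - P *ᵥ w) := by
  let f : (S → ℝ) →ₗ[ℝ] (S → ℝ) := LinearMap.id - P.mulVecLin
  have hf : ∀ x, f x = x - P *ᵥ x := fun x => by simp [f]
  -- The Cesàro averages of a fixed coboundary are constant, yet tend to zero by telescoping. So
  -- kernel and range of I − P meet trivially, and by rank-nullity they are complementary.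
  have hdisj : Disjoint (LinearMap.ker f) (LinearMap.range f) := by
    rw [Submodule.disjoint_def]
    rintro x hx ⟨w, rfl⟩
    rw [LinearMap.mem_ker, hf (f w), sub_eq_zero] at hx
    ext s
    have h1 := tendsto_cesaro_sub hP w s
    rw [← hf w] at h1
    simp only [pow_mulVec_of_fixed hx.symm, Finset.sum_const, Finset.card_range, nsmul_eq_mul] at h1
    refine tendsto_nhds_unique (tendsto_const_nhds.congr' ?_) h1
    filter_upwards [eventually_gt_atTop 0] with T hT
    have : (T : ℝ) ≠ 0 := by positivity
    field_simp
  have htop := Submodule.eq_top_of_disjoint _ _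
    (by rw [add_comm, LinearMap.finrank_range_add_finrank_ker]) hdisj
  obtain ⟨u, hu, _, ⟨w, rfl⟩, hv⟩ := Submodule.mem_sup.1 (htop ▸ Submodule.mem_top : v ∈ _)
  refine ⟨u, w, ?_, by rw [← hv, hf]⟩
  rw [LinearMap.mem_ker, hf, sub_eq_zero] at hu
  exact hu.symm

lemma exists_tendsto_cesaro (hP : P ∈ Matrix.rowStochastic ℝ S) (v : S → ℝ) :
    ∃ u : S → ℝ, ∀ s, Tendsto (fun T : ℕ => (T : ℝ)⁻¹ *
      ∑ t ∈ Finset.range T, ((P ^ t) *ᵥ v) s) atTop (𝓝 (u s)) := by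
  obtain ⟨u, w, hu, rfl⟩ := exists_fixed_add_coboundary hP v
  refine ⟨u, fun s => ?_⟩
  have h1 := (tendsto_cesaro_sub hP w s).const_add (u s)
  rw [add_zero] at h1
  refine h1.congr' ?_
  filter_upwards [eventually_gt_atTop 0] with T hT
  have : (T : ℝ) ≠ 0 := by positivity
  simp only [Matrix.mulVec_add, pow_mulVec_of_fixed hu, Pi.add_apply, Finset.sum_add_distrib,
    Finset.sum_const, Finset.card_range, nsmul_eq_mul]
  field_simp

/-- The limiting occupation measure of a finite Markov chain. -/
lemma exists_occupation (hP : P ∈ Matrix.rowStochastic ℝ S) (μ : stdSimplex ℝ S) :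
    ∃ m : S → ℝ, (∀ s, 0 ≤ m s) ∧ ∑ s, m s = 1 ∧
      (∀ v : S → ℝ, ∑ s, m s * (P *ᵥ v) s = ∑ s, m s * v s) ∧
      ∀ v u : S → ℝ, (∀ s, Tendsto (fun T : ℕ => (T : ℝ)⁻¹ *
        ∑ t ∈ Finset.range T, ((P ^ t) *ᵥ v) s) atTop (𝓝 (u s))) →
        ∑ s, μ.1 s * u s = ∑ s, m s * v s := by
  choose L hL using exists_tendsto_cesaro hP
  have hLlin : ∀ v s, L v s = ∑ s', v s' * L (Pi.single s' 1) s := by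
    intro v s
    refine tendsto_nhds_unique (hL v s) ?_
    have := tendsto_finsetSum Finset.univ fun s' _ =>
      (hL (Pi.single s' 1) s).const_mul (v s')
    refine this.congr fun T => ?_
    simp only [Matrix.mulVec_single_one, Matrix.col_apply, Finset.mul_sum]
    rw [Finset.sum_comm]
    refine Finset.sum_congr rfl fun t _ => ?_
    rw [Matrix.mulVec, dotProduct, Finset.mul_sum]
    refine Finset.sum_congr rfl fun s' _ => ?_
    ring
  have key : ∀ v u : S → ℝ, (∀ s, Tendsto (fun T : ℕ => (T : ℝ)⁻¹ *
        ∑ t ∈ Finset.range T, ((P ^ t) *ᵥ v) s) atTop (𝓝 (u s))) →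
        ∑ s, μ.1 s * u s = ∑ s', (∑ s, μ.1 s * L (Pi.single s' 1) s) * v s' := by
    intro v u hu
    have : ∀ s, u s = L v s := fun s => tendsto_nhds_unique (hu s) (hL v s)
    simp only [this, hLlin v, Finset.mul_sum, Finset.sum_mul]
    rw [Finset.sum_comm]
    refine Finset.sum_congr rfl fun s' _ => Finset.sum_congr rfl fun s _ => ?_
    ring
  refine ⟨fun s' => ∑ s, μ.1 s * L (Pi.single s' 1) s, fun s' => ?_, ?_, fun v => ?_, key⟩
  · refine Finset.sum_nonneg fun s _ => mul_nonneg (μ.2.1 s) ?_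
    refine ge_of_tendsto' (hL _ s) fun T => mul_nonneg (by positivity) ?_
    refine Finset.sum_nonneg fun t _ => ?_
    refine Matrix.nonneg_mulVec_of_mem_rowStochastic (pow_mem hP t) (fun i => ?_) s
    by_cases h : i = s' <;> simp [h]
  · have := key 1 1 fun s => by
      refine tendsto_const_nhds.congr' ?_
      filter_upwards [eventually_gt_atTop 0] with T hT
      have : (T : ℝ) ≠ 0 := by positivity
      simp only [pow_mulVec_of_fixed hP.2, Pi.one_apply, Finset.sum_const, Finset.card_range,
        nsmul_eq_mul]
      field_simp
    simp only [Pi.one_apply, mul_one] at this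
    rw [← this]
    exact μ.2.2
  -- Invariance of the occupation measure: coboundaries have zero Cesàro limit.
  · have := key (v - P *ᵥ v) 0 fun s => tendsto_cesaro_sub hP v s
    simp only [Pi.zero_apply, mul_zero, Finset.sum_const_zero, Pi.sub_apply, mul_sub,
      Finset.sum_sub_distrib] at this
    linarith

end Cesaro

/-! ### Average reward, bias and hitting times of a policy. -/

namespace CAMDP

variable {S A : Type} [Fintype S] [DecidableEq S] [Fintype A]

lemma chain_mem_rowStochastic (M : CAMDP S A) (π : Policy S A) :
    M.chain π ∈ Matrix.rowStochastic ℝ S := by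
  rw [Matrix.mem_rowStochastic_iff_sum]
  refine ⟨fun s s' => Finset.sum_nonneg fun a _ => mul_nonneg ((π s).2.1 a) ((M.P s a).2.1 s'),
    fun s => ?_⟩
  simp only [chain]
  rw [Finset.sum_comm]
  simp only [← Finset.mul_sum]
  rw [← (π s).2.2]
  refine Finset.sum_congr rfl fun a _ => ?_
  rw [(M.P s a).2.2, mul_one]

omit [DecidableEq S] in
lemma chain_mulVec (M : CAMDP S A) (π : Policy S A) (v : S → ℝ) (s : S) :
    (M.chain π *ᵥ v) s = ∑ a, (π s).1 a * ∑ s', (M.P s a).1 s' * v s' := by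
  simp only [Matrix.mulVec, dotProduct, chain, Finset.sum_mul, Finset.mul_sum]
  rw [Finset.sum_comm]
  simp only [mul_assoc]

lemma tendsto_gainAt (M : CAMDP S A) (f : S → A → ℝ) (π : Policy S A) (s : S) :
    Tendsto (fun T : ℕ => (T : ℝ)⁻¹ * ∑ t ∈ Finset.range T, M.expectAt f π t s) atTop
      (𝓝 (M.gainAt f π s)) := by
  obtain ⟨u, hu⟩ := exists_tendsto_cesaro (M.chain_mem_rowStochastic π)
    fun s' => ∑ a, (π s').1 a * f s' a
  exact tendsto_nhds_limUnder ⟨u s, hu s⟩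

/-- The average reward is the integral of the reward with respect to a stationary distribution. -/
lemma exists_stationary (M : CAMDP S A) (π : Policy S A) :
    ∃ m : S → ℝ, (∀ s, 0 ≤ m s) ∧ ∑ s, m s = 1 ∧
      (∀ v : S → ℝ, ∑ s, m s * ∑ a, (π s).1 a * ∑ s', (M.P s a).1 s' * v s' =
        ∑ s, m s * v s) ∧
      ∀ f : S → A → ℝ, M.gain f π = ∑ s, m s * ∑ a, (π s).1 a * f s a := by
  obtain ⟨m, h0, h1, h2, h3⟩ := exists_occupation (M.chain_mem_rowStochastic π) M.init
  refine ⟨m, h0, h1, fun v => ?_, fun f => h3 _ _ fun s => M.tendsto_gainAt f π s⟩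
  simpa only [chain_mulVec] using h2 v

lemma gain_le_one (M : CAMDP S A) {f : S → A → ℝ} (hf : ∀ s a, f s a ≤ 1) (π : Policy S A) :
    M.gain f π ≤ 1 := by
  obtain ⟨m, h0, h1, -, h3⟩ := M.exists_stationary π
  rw [h3, ← h1]
  refine Finset.sum_le_sum fun s _ => mul_le_of_le_one_right (h0 s) ?_
  rw [← (π s).2.2]
  exact Finset.sum_le_sum fun a _ => mul_le_of_le_one_right ((π s).2.1 a) (hf s a)

/-- A solution of Poisson's equation bounds the bias. -/
lemma abs_bias_le (M : CAMDP S A) (f : S → A → ℝ) (π : Policy S A) {g B : ℝ} {h : S → ℝ}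
    (hB : ∀ s, |h s| ≤ B)
    (hh : ∀ s, ∑ a, (π s).1 a * f s a = g + (h s - (M.chain π *ᵥ h) s)) (s : S) :
    |M.bias f π s| ≤ 2 * B := by
  have hP := M.chain_mem_rowStochastic π
  have hgain : ∀ s, M.gainAt f π s = g := by
    intro s
    refine tendsto_nhds_unique (M.tendsto_gainAt f π s) ?_
    have h1 := (tendsto_cesaro_sub hP h s).const_add g
    rw [add_zero] at h1
    refine h1.congr' ?_
    filter_upwards [eventually_gt_atTop 0] with T hT
    have : (T : ℝ) ≠ 0 := by positivity
    have h2 : (fun s' => ∑ a, (π s').1 a * f s' a)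
        = g • (1 : S → ℝ) + (h - M.chain π *ᵥ h) := by
      ext s'; simp [hh s']
    simp only [expectAt, h2, Matrix.mulVec_add, Matrix.mulVec_smul, pow_mulVec_of_fixed hP.2,
      Pi.add_apply, Pi.smul_apply, Pi.one_apply, smul_eq_mul, Finset.sum_add_distrib,
      Finset.sum_const, Finset.card_range, nsmul_eq_mul]
    field_simp
  have hsum : ∀ T, ∑ t ∈ Finset.range T,
      M.expectAt (fun s' a => f s' a - M.gainAt f π s') π t s =
        h s - ((M.chain π ^ T) *ᵥ h) s := by
    intro T
    rw [← sum_pow_mulVec_sub_apply]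
    refine Finset.sum_congr rfl fun t _ => ?_
    have h2 : (fun s' => ∑ a, (π s').1 a * (f s' a - M.gainAt f π s'))
        = h - M.chain π *ᵥ h := by
      ext s'
      have := (π s').2.2
      simp only [mul_sub, Finset.sum_sub_distrib, ← Finset.sum_mul, this, hh s', hgain,
        Pi.sub_apply]
      ring
    simp only [expectAt, h2]
  have hbd : ∀ N : ℕ, |(N : ℝ)⁻¹ * ∑ T ∈ Finset.Icc 1 N, (h s - ((M.chain π ^ T) *ᵥ h) s)|
      ≤ 2 * B := by
    intro N
    have hB0 : 0 ≤ B := (abs_nonneg _).trans (hB s)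
    rw [abs_mul, abs_of_nonneg (by positivity : (0 : ℝ) ≤ (N : ℝ)⁻¹)]
    have h3 : |∑ T ∈ Finset.Icc 1 N, (h s - ((M.chain π ^ T) *ᵥ h) s)| ≤ N * (2 * B) := by
      refine (Finset.abs_sum_le_sum_abs _ _).trans ?_
      have : ∑ T ∈ Finset.Icc 1 N, |h s - ((M.chain π ^ T) *ᵥ h) s|
          ≤ ∑ T ∈ Finset.Icc 1 N, 2 * B := by
        refine Finset.sum_le_sum fun T _ => (abs_sub _ _).trans ?_
        linarith [hB s, abs_pow_mulVec_le hP hB T s]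
      simpa using this
    rcases Nat.eq_zero_or_pos N with rfl | hN
    · simpa using hB0
    · have : (0 : ℝ) < N := by exact_mod_cast hN
      rw [inv_mul_le_iff₀ this]
      exact h3
  -- `limUnder` has no meaning unless the limit exists, so convergence is needed before the bound
  -- can pass to it. As T starts at 1, the averages are those of the orbit of `M.chain π *ᵥ h`.
  have hex : ∃ x, Tendsto (fun N : ℕ => (N : ℝ)⁻¹ * ∑ T ∈ Finset.Icc 1 N,
      (h s - ((M.chain π ^ T) *ᵥ h) s)) atTop (𝓝 x) := by
    obtain ⟨u, hu⟩ := exists_tendsto_cesaro hP (M.chain π *ᵥ h)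
    refine ⟨h s - u s, ((hu s).const_sub (h s)).congr' ?_⟩
    filter_upwards [eventually_gt_atTop 0] with N hN
    have : (N : ℝ) ≠ 0 := by positivity
    have h4 : ∑ T ∈ Finset.Icc 1 N, ((M.chain π ^ T) *ᵥ h) s =
        ∑ t ∈ Finset.range N, ((M.chain π ^ t) *ᵥ (M.chain π *ᵥ h)) s := by
      rw [Finset.range_eq_Ico, Finset.sum_Ico_eq_sum_range, ← Finset.Ico_add_one_right_eq_Icc,
        Finset.sum_Ico_eq_sum_range]
      simp [Matrix.mulVec_mulVec, ← pow_succ, add_comm]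
    simp only [Finset.sum_sub_distrib, h4, Finset.sum_const, Nat.card_Icc, nsmul_eq_mul,
      add_tsub_cancel_right]
    field_simp
  have hlim := tendsto_nhds_limUnder hex
  simp only [bias, hsum]
  exact le_of_tendsto' hlim.abs hbd

omit [Fintype S] [DecidableEq S] in
lemma spanNorm_le [Nonempty S] {v : S → ℝ} {B : ℝ} (hv : ∀ s, |v s| ≤ B) :
    spanNorm v ≤ 2 * B := by
  have h1 : (⨆ s, v s) ≤ B := ciSup_le fun s => (abs_le.1 (hv s)).2
  have h2 : -B ≤ ⨅ s, v s := le_ciInf fun s => (abs_le.1 (hv s)).1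
  rw [spanNorm]; linarith

/-- A supersolution of the hitting time equations bounds the expected hitting time. -/
lemma hittingTime_le (M : CAMDP S A) (π : Policy S A) (g : S) {V : S → ℝ} (hV : ∀ s, 0 ≤ V s)
    (h : ∀ s, s ≠ g → 1 + (M.chain π *ᵥ V) s ≤ V s) (s : S) :
    M.hittingTime π g s ≤ ENNReal.ofReal (V s) := by
  have hP := M.chain_mem_rowStochastic π
  have hnn : ∀ n s, 0 ≤ M.avoidProb π g n s := by
    intro n
    induction n with
    | zero => intro s; simp only [avoidProb]; split_ifs <;> norm_num
    | succ n ih =>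
      intro s; simp only [avoidProb]; split_ifs
      · exact le_rfl
      · exact Finset.sum_nonneg fun s' _ =>
          mul_nonneg (Matrix.nonneg_of_mem_rowStochastic hP) (ih s')
  -- The hitting time truncated at N obeys the same one-step recursion, so the supersolution
  -- dominates it by induction on N.
  have hsum : ∀ N s, ∑ n ∈ Finset.range N, M.avoidProb π g n s ≤ V s := by
    intro N
    induction N with
    | zero => intro s; simpa using hV s
    | succ N ih =>
      intro s
      by_cases hs : s = g
      · have : ∀ n, M.avoidProb π g n s = 0 := fun n => by cases n <;> simp [avoidProb, hs]
        simpa [this] using hV s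
      · rw [Finset.sum_range_succ']
        simp only [avoidProb, hs, if_false]
        rw [Finset.sum_comm]
        simp only [← Finset.mul_sum]
        have : ∑ s', M.chain π s s' * ∑ n ∈ Finset.range N, M.avoidProb π g n s'
            ≤ (M.chain π *ᵥ V) s :=
          Finset.sum_le_sum fun s' _ => mul_le_mul_of_nonneg_left (ih s')
            (Matrix.nonneg_of_mem_rowStochastic hP)
        linarith [h s hs]
  rw [hittingTime]
  refine ENNReal.tsum_le_of_sum_range_le fun N => ?_
  rw [← ENNReal.ofReal_sum_of_nonneg fun n _ => hnn n s]
  exact ENNReal.ofReal_le_ofReal (hsum N s)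

end CAMDP

end AvgCMDP

/-! ### Sampling procedures: histories, stopping and expected sample counts. -/

namespace AvgCMDP

lemma tsum_list_eq {X : Type*} (f : List X → ℝ≥0∞) :
    ∑' h, f h = f [] + ∑' (x : X) (t : List X), f (x :: t) := by
  classical
  rw [ENNReal.tsum_eq_add_tsum_ite []]
  congr 1
  let g : X × List X → List X := fun z => z.1 :: z.2
  have hg : Function.Injective g := fun z w h => by
    have := List.cons.inj h
    exact Prod.ext this.1 this.2
  rw [← hg.tsum_eq, ENNReal.tsum_prod']
  · simp [g]
  · intro h hh
    cases h with
    | nil => simp at hh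
    | cons x t => exact ⟨(x, t), rfl⟩

namespace Sampler

variable {S A : Type} [Fintype S] [Fintype A]

lemma next_add_sum (L : Sampler S A) (h : List (S × A × S)) :
    L.next h none + ∑ s, ∑ a, L.next h (some (s, a)) = 1 := by
  rw [← (L.next h).tsum_coe, tsum_fintype, Fintype.sum_option, Fintype.sum_prod_type]

lemma sum_ofReal_law (μ : stdSimplex ℝ S) : ∑ s, ENNReal.ofReal (μ.1 s) = 1 := by
  rw [← ENNReal.ofReal_sum_of_nonneg fun s _ => μ.2.1 s, μ.2.2, ENNReal.ofReal_one]

/-- Histories are newest first, so a nonempty one is a shorter history followed by one more sample.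
The sum over all histories is the expected total of `V` along a run. -/
lemma tsum_reachProb_mul (L : Sampler S A) (P : S → A → stdSimplex ℝ S)
    (V : List (S × A × S) → ℝ≥0∞) :
    ∑' h, L.reachProb P h * V h = V [] + ∑' h, L.reachProb P h * ∑ s, ∑ a,
      L.next h (some (s, a)) * ∑ s', ENNReal.ofReal ((P s a).1 s') * V ((s, a, s') :: h) := by
  rw [tsum_list_eq]
  congr 1
  · simp [reachProb]
  · rw [ENNReal.tsum_comm]
    refine tsum_congr fun h => ?_
    rw [tsum_fintype, Fintype.sum_prod_type, Finset.mul_sum]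
    refine Finset.sum_congr rfl fun s _ => ?_
    rw [Fintype.sum_prod_type, Finset.mul_sum]
    refine Finset.sum_congr rfl fun a _ => ?_
    rw [Finset.mul_sum, Finset.mul_sum]
    refine Finset.sum_congr rfl fun s' _ => ?_
    simp only [reachProb]
    ring

/-- The probability-weighted total of `φ` over the histories at which the procedure stops. -/
noncomputable def stopSum (L : Sampler S A) (P : S → A → stdSimplex ℝ S) (φ : List (S × A × S) → ℝ≥0∞) :
    ℝ≥0∞ :=
  ∑' h, L.reachProb P h * L.next h none * φ h

lemma stopSum_add (L : Sampler S A) (P : S → A → stdSimplex ℝ S)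
    (φ ψ : List (S × A × S) → ℝ≥0∞) :
    L.stopSum P (fun h => φ h + ψ h) = L.stopSum P φ + L.stopSum P ψ := by
  simp only [stopSum, mul_add, ENNReal.tsum_add]

lemma stopSum_mono (L : Sampler S A) (P : S → A → stdSimplex ℝ S)
    {φ ψ : List (S × A × S) → ℝ≥0∞} (h : ∀ x, φ x ≤ ψ x) :
    L.stopSum P φ ≤ L.stopSum P ψ :=
  ENNReal.tsum_le_tsum fun x => mul_le_mul_right (h x) _

lemma returnProb_eq_stopSum (L : Sampler S A) (P : S → A → stdSimplex ℝ S)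
    (G : Set (Policy S A)) : L.returnProb P G =
      L.stopSum P fun h => (L.output h : MeasureTheory.Measure (Policy S A)) G := rfl

/-- The expected number of samples drawn at `x`. -/
noncomputable def expectedVisits (L : Sampler S A) (P : S → A → stdSimplex ℝ S) (x : S × A) : ℝ≥0∞ :=
  ∑' h, L.reachProb P h * L.next h (some x)

lemma expectedSamples_eq_sum (L : Sampler S A) (P : S → A → stdSimplex ℝ S) :
    L.expectedSamples P = ∑ x : S × A, L.expectedVisits P x := by
  rw [Fintype.sum_prod_type]; rfl

/-- At every reached history the procedure either stops or draws once more. -/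
lemma stopSum_add_tsum (L : Sampler S A) (P : S → A → stdSimplex ℝ S)
    (V : List (S × A × S) → ℝ≥0∞) :
    L.stopSum P V + ∑' h, L.reachProb P h * ∑ s, ∑ a, L.next h (some (s, a)) * V h =
      ∑' h, L.reachProb P h * V h := by
  rw [stopSum, ← ENNReal.tsum_add]
  refine tsum_congr fun h => ?_
  simp only [← Finset.sum_mul]
  rw [mul_assoc, ← mul_add, ← add_mul, L.next_add_sum, one_mul]

/-- A one-step drift inequality for `V` bounds its expectation upon stopping. -/
lemma stopSum_le_of_drift (L : Sampler S A) (P : S → A → stdSimplex ℝ S)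
    {V : List (S × A × S) → ℝ≥0∞} {c : S → A → ℝ≥0∞}
    (hfin : ∑' h, L.reachProb P h * V h ≠ ∞)
    (hV : ∀ s a s' h, V ((s, a, s') :: h) ≤ V h + c s a) :
    L.stopSum P V ≤ V [] + ∑ s, ∑ a, c s a * L.expectedVisits P (s, a) := by
  have h1 := L.stopSum_add_tsum P V
  have h2 := L.tsum_reachProb_mul P V
  have h3 : ∑' h, L.reachProb P h * ∑ s, ∑ a, L.next h (some (s, a)) *
      ∑ s', ENNReal.ofReal ((P s a).1 s') * V ((s, a, s') :: h) ≤
      (∑' h, L.reachProb P h * ∑ s, ∑ a, L.next h (some (s, a)) * V h) +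
        ∑ s, ∑ a, c s a * L.expectedVisits P (s, a) := by
    have h4 : ∑ s, ∑ a, c s a * L.expectedVisits P (s, a) =
        ∑' h, L.reachProb P h * ∑ s, ∑ a, L.next h (some (s, a)) * c s a := by
      simp only [Finset.mul_sum, expectedVisits, ← ENNReal.tsum_mul_left]
      rw [Summable.tsum_finsetSum fun _ _ => ENNReal.summable]
      refine Finset.sum_congr rfl fun s _ => ?_
      rw [Summable.tsum_finsetSum fun _ _ => ENNReal.summable]
      refine Finset.sum_congr rfl fun a _ => tsum_congr fun h => ?_
      ring
    rw [h4, ← ENNReal.tsum_add]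
    refine ENNReal.tsum_le_tsum fun h => ?_
    rw [← mul_add, ← Finset.sum_add_distrib]
    simp only [← Finset.sum_add_distrib, ← mul_add]
    gcongr with s _ a _
    calc ∑ s', ENNReal.ofReal ((P s a).1 s') * V ((s, a, s') :: h)
        ≤ ∑ s', ENNReal.ofReal ((P s a).1 s') * (V h + c s a) := by
          gcongr with s' _; exact hV s a s' h
      _ = V h + c s a := by rw [← Finset.sum_mul, sum_ofReal_law, one_mul]
  -- Finiteness allows the continuation term, common to both identities, to be cancelled in `ℝ≥0∞`.
  have h5 : ∑' h, L.reachProb P h * ∑ s, ∑ a, L.next h (some (s, a)) * V h ≠ ∞ := by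
    intro h6
    rw [h6, add_top] at h1
    exact hfin h1.symm
  rw [← ENNReal.add_le_add_iff_right h5, h1, h2, add_assoc]
  gcongr
  rw [add_comm]
  exact h3

lemma tsum_reachProb (L : Sampler S A) (P : S → A → stdSimplex ℝ S) :
    ∑' h, L.reachProb P h = 1 + L.expectedSamples P := by
  have h1 := L.tsum_reachProb_mul P 1
  simp only [Pi.one_apply, mul_one, sum_ofReal_law] at h1
  rw [h1, expectedSamples]
  congr 1
  simp only [Finset.mul_sum]
  rw [Summable.tsum_finsetSum fun _ _ => ENNReal.summable]
  refine Finset.sum_congr rfl fun s _ => ?_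
  rw [Summable.tsum_finsetSum fun _ _ => ENNReal.summable]

lemma stopSum_one (L : Sampler S A) (P : S → A → stdSimplex ℝ S)
    (hfin : L.expectedSamples P ≠ ∞) : L.stopSum P (fun _ => 1) = 1 := by
  have h1 := L.stopSum_add_tsum P 1
  have h2 := L.tsum_reachProb P
  have h3 : ∑' h, L.reachProb P h * ∑ s, ∑ a, L.next h (some (s, a)) * (1 : List _ → ℝ≥0∞) h
      = L.expectedSamples P := by
    simp only [Pi.one_apply, mul_one, Finset.mul_sum, expectedSamples]
    rw [Summable.tsum_finsetSum fun _ _ => ENNReal.summable]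
    refine Finset.sum_congr rfl fun s _ => ?_
    rw [Summable.tsum_finsetSum fun _ _ => ENNReal.summable]
  rw [h3] at h1
  simp only [Pi.one_apply, mul_one, h2] at h1
  exact (ENNReal.add_left_inj hfin).1 h1

lemma tsum_reachProb_truncated_le (L : Sampler S A) (P : S → A → stdSimplex ℝ S) (k : ℕ) :
    ∑' h, L.reachProb P h * (if h.length ≤ k then 1 else 0) ≤ k + 1 := by
  have step : ∀ V W : List (S × A × S) → ℝ≥0∞,
      (∀ s a s' h, V ((s, a, s') :: h) ≤ W h) →
      ∑' h, L.reachProb P h * V h ≤ V [] + ∑' h, L.reachProb P h * W h := by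
    intro V W hW
    rw [tsum_reachProb_mul]
    gcongr with h
    calc ∑ s, ∑ a, L.next h (some (s, a)) *
          ∑ s', ENNReal.ofReal ((P s a).1 s') * V ((s, a, s') :: h)
        ≤ ∑ s, ∑ a, L.next h (some (s, a)) *
          ∑ s', ENNReal.ofReal ((P s a).1 s') * W h := by
          gcongr with s _ a _ s' _; exact hW s a s' h
      _ = (∑ s, ∑ a, L.next h (some (s, a))) * W h := by
          simp only [← Finset.sum_mul, sum_ofReal_law, one_mul]
      _ ≤ 1 * W h := by
          gcongr
          rw [← L.next_add_sum h]
          exact le_add_self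
      _ = W h := one_mul _
  induction k with
  | zero =>
    refine (step _ 0 fun s a s' h => by simp).trans ?_
    simp
  | succ k ih =>
    refine (step _ (fun h => if h.length ≤ k then 1 else 0) fun s a s' h => by simp).trans ?_
    simp only [List.length_nil, Nat.zero_le, if_true]
    rw [add_comm]
    push_cast
    gcongr

/-- Needed without any finiteness of the sample count, which is not available for the perturbed and
auxiliary laws. The indicator of length at most k has finite total and never increases along a run,
so the drift bound applies to it; finite sets of histories have bounded length. -/
lemma stopSum_one_le (L : Sampler S A) (P : S → A → stdSimplex ℝ S) :
    L.stopSum P (fun _ => 1) ≤ 1 := by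
  have key : ∀ k : ℕ, L.stopSum P (fun h => if h.length ≤ k then 1 else 0) ≤ 1 := by
    intro k
    refine (L.stopSum_le_of_drift P (c := fun _ _ => 0) ?_ ?_).trans ?_
    · exact ((L.tsum_reachProb_truncated_le P k).trans_lt (by simp)).ne
    · intro s a s' h
      simp only [List.length_cons, add_zero]
      split_ifs <;> first | omega | simp
    · simp
  rw [stopSum, ENNReal.tsum_eq_iSup_sum]
  refine iSup_le fun F => ?_
  refine le_trans ?_ (key (F.sup List.length))
  refine le_trans (Finset.sum_le_sum fun h hh => ?_) (ENNReal.sum_le_tsum F)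
  simp only [if_pos (Finset.le_sup (f := List.length) hh), le_refl]

/-! ### Visit counts and change of measure. -/

variable [DecidableEq S] [DecidableEq A]

/-- The number of samples at `x` in a history. -/
def visits (x : S × A) : List (S × A × S) → ℕ
  | [] => 0
  | (s, a, _) :: h => visits x h + if (s, a) = x then 1 else 0

omit [Fintype S] [Fintype A] in
lemma visits_cons (x : S × A) (s : S) (a : A) (s' : S) (h : List (S × A × S)) :
    visits x ((s, a, s') :: h) = visits x h + if (s, a) = x then 1 else 0 := rfl

/-- Markov's inequality for the number of samples at `x`. -/
lemma stopSum_visits_le (L : Sampler S A) (P : S → A → stdSimplex ℝ S)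
    (hfin : L.expectedSamples P ≠ ∞) (x : S × A) {K : ℕ} (hK : 0 < K) :
    L.stopSum P (fun h => if K ≤ visits x h then 1 else 0) ≤ L.expectedVisits P x / K := by
  have hK' : (K : ℝ≥0∞) ≠ 0 := by exact_mod_cast hK.ne'
  rw [ENNReal.le_div_iff_mul_le (Or.inl hK') (Or.inl (by simp))]
  have h1 : L.stopSum P (fun h => if K ≤ visits x h then 1 else 0) * K ≤
      L.stopSum P (fun h => ((min (visits x h) K : ℕ) : ℝ≥0∞)) := by
    rw [stopSum, ← ENNReal.tsum_mul_right]
    refine ENNReal.tsum_le_tsum fun h => ?_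
    rw [mul_assoc]
    gcongr
    split_ifs with hh
    · simp [min_eq_right hh]
    · simp
  refine h1.trans ((L.stopSum_le_of_drift P (c := fun s a => if (s, a) = x then 1 else 0)
    ?_ ?_).trans ?_)
  · refine ne_top_of_le_ne_top (b := (∑' h, L.reachProb P h) * K) ?_ ?_
    · rw [tsum_reachProb]
      exact ENNReal.mul_ne_top (by simp [hfin]) (by simp)
    · rw [← ENNReal.tsum_mul_right]
      refine ENNReal.tsum_le_tsum fun h => ?_
      gcongr
      exact min_le_right _ _
  · intro s a s' h
    rw [visits_cons]
    split_ifs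
    · exact_mod_cast (by omega : min (visits x h + 1) K ≤ min (visits x h) K + 1)
    · simp
  · simp only [visits, Nat.zero_min, Nat.cast_zero, zero_add, ite_mul, one_mul, zero_mul]
    rw [← Fintype.sum_prod_type (f := fun z : S × A => if z = x then L.expectedVisits P z else 0)]
    simp

omit [DecidableEq S] [DecidableEq A] in
lemma reachProb_le_one (L : Sampler S A) (P : S → A → stdSimplex ℝ S)
    (h : List (S × A × S)) : L.reachProb P h ≤ 1 := by
  induction h with
  | nil => simp [reachProb]
  | cons e h ih =>
    obtain ⟨s, a, s'⟩ := e
    simp only [reachProb]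
    refine mul_le_one' (mul_le_one' ih (PMF.coe_le_one _ _)) ?_
    rw [← sum_ofReal_law (P s a)]
    exact Finset.single_le_sum (f := fun z => ENNReal.ofReal ((P s a).1 z))
      (fun _ _ => zero_le) (Finset.mem_univ s')

/-- The procedure's own choices contribute the same squared factor to both sides, so only the
sampled transitions matter, and each visit to `x` costs one factor θ. -/
lemma reachProb_sq_le (L : Sampler S A) {P₀ P₁ P₂ : S → A → stdSimplex ℝ S} {x : S × A} {θ : ℝ}
    (hθ : 0 ≤ θ)
    (hP : ∀ s a s', (P₀ s a).1 s' ^ 2 ≤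
      (if (s, a) = x then θ else 1) * ((P₂ s a).1 s' * (P₁ s a).1 s'))
    (h : List (S × A × S)) :
    L.reachProb P₀ h ^ 2 ≤
      ENNReal.ofReal θ ^ visits x h * (L.reachProb P₂ h * L.reachProb P₁ h) := by
  induction h with
  | nil => simp [reachProb, visits]
  | cons e h ih =>
    obtain ⟨s, a, s'⟩ := e
    simp only [reachProb, visits]
    have h1 : ENNReal.ofReal ((P₀ s a).1 s') ^ 2 ≤
        ENNReal.ofReal θ ^ (if (s, a) = x then 1 else 0) *
          (ENNReal.ofReal ((P₂ s a).1 s') * ENNReal.ofReal ((P₁ s a).1 s')) := by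
      rw [← ENNReal.ofReal_pow ((P₀ s a).2.1 s'), ← ENNReal.ofReal_mul ((P₂ s a).2.1 s')]
      have := hP s a s'
      split_ifs with hx
      · rw [if_pos hx] at this
        rw [pow_one, ← ENNReal.ofReal_mul hθ]
        exact ENNReal.ofReal_le_ofReal this
      · rw [if_neg hx, one_mul] at this
        rw [pow_zero, one_mul]
        exact ENNReal.ofReal_le_ofReal this
    calc (L.reachProb P₀ h * L.next h (some (s, a)) * ENNReal.ofReal ((P₀ s a).1 s')) ^ 2
        = L.reachProb P₀ h ^ 2 * ENNReal.ofReal ((P₀ s a).1 s') ^ 2 *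
          L.next h (some (s, a)) ^ 2 := by ring
      _ ≤ _ := mul_le_mul_left (mul_le_mul' ih h1) _
      _ = _ := by rw [pow_add]; ring

omit [Fintype S] [Fintype A] [DecidableEq S] [DecidableEq A] in
-- AM-GM in the form 4wv ≤ (2v + w/2)². It linearizes the likelihood comparison history by history,
-- so that it can be summed.
lemma two_mul_le_of_sq_le {u v w : ℝ≥0∞} (hu : u ≤ 1) (hv : v ≤ 1) (hw : w ≠ ∞)
    (h : u ^ 2 ≤ w * v) : 2 * u ≤ 2 * v + w / 2 := by
  lift u to NNReal using ne_top_of_le_ne_top (by simp) hu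
  lift v to NNReal using ne_top_of_le_ne_top (by simp) hv
  lift w to NNReal using hw
  have h' : u ^ 2 ≤ w * v := by exact_mod_cast h
  have h2 : (2 : ℝ≥0∞) = ((2 : NNReal) : ℝ≥0∞) := rfl
  rw [h2, ← ENNReal.coe_div (by norm_num)]
  norm_cast
  rw [← NNReal.coe_le_coe] at h' ⊢
  push_cast at h' ⊢
  have := u.2; have := v.2; have := w.2
  simp only [NNReal.val_eq_coe] at *
  refine abs_le_of_sq_le_sq' (a := 2 * (u : ℝ)) ?_ (by positivity) |>.2
  nlinarith [sq_nonneg (2 * (v : ℝ) - w / 2)]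

/-- If under `P₁` the returned policy lies in `E` with probability at least `3 / 4`, then under
`P₀` either it lies in `E` with a nonnegligible probability, or `x` is sampled often. -/
lemma le_returnProb_add_expectedVisits (L : Sampler S A) {P₀ P₁ P₂ : S → A → stdSimplex ℝ S}
    {x : S × A} {θ : ℝ} (hθ : 1 ≤ θ)
    (hP : ∀ s a s', (P₀ s a).1 s' ^ 2 ≤
      (if (s, a) = x then θ else 1) * ((P₂ s a).1 s' * (P₁ s a).1 s'))
    {E : Set (Policy S A)} (hE : MeasurableSet E) (hret : 3 / 4 ≤ L.returnProb P₁ E)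
    (hfin : L.expectedSamples P₀ ≠ ∞) {K : ℕ} (hK : 0 < K) (hθK : θ ^ K ≤ 4 / 3) :
    ENNReal.ofReal (5 / 12) ≤ L.returnProb P₀ E + L.expectedVisits P₀ x / K := by
  set φ : List (S × A × S) → ℝ≥0∞ :=
    fun h => (L.output h : MeasureTheory.Measure (Policy S A)) E
  set ψ : List (S × A × S) → ℝ≥0∞ :=
    fun h => (L.output h : MeasureTheory.Measure (Policy S A)) Eᶜ
  have hφψ : ∀ h, φ h + ψ h = 1 := fun h => MeasureTheory.prob_add_prob_compl hE
  have hψ1 : ∀ h, ψ h ≤ 1 := fun h => (hφψ h) ▸ le_add_self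
  set χ : List (S × A × S) → ℝ≥0∞ := fun h => if visits x h < K then ψ h else 0
  -- Upon stopping, the output lies in `E`, or it misses `E` after fewer than `K` visits, or there
  -- were at least `K` visits. Only the middle event is compared with `P₁`.
  have h0 : 1 ≤ L.stopSum P₀ φ + L.stopSum P₀ χ +
      L.stopSum P₀ (fun h => if K ≤ visits x h then 1 else 0) := by
    rw [← stopSum_add, ← stopSum_add]
    refine (L.stopSum_one P₀ hfin).ge.trans (L.stopSum_mono P₀ fun h => ?_)
    refine (hφψ h).ge.trans ?_
    simp only [χ]
    split_ifs with h1 h2 h2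
    · omega
    · simp
    · rw [add_zero]; gcongr; exact hψ1 h
    · omega
  have h1 : L.stopSum P₁ ψ ≤ 1 / 4 := by
    have h2 : L.stopSum P₁ φ + L.stopSum P₁ ψ ≤ 1 := by
      rw [← stopSum_add]; simp only [hφψ]; exact L.stopSum_one_le P₁
    have h3 : 3 / 4 + L.stopSum P₁ ψ ≤ 1 := le_trans (by gcongr; exact hret) h2
    have h4 : (1 : ℝ≥0∞) = 3 / 4 + 1 / 4 := by
      rw [← ENNReal.toReal_eq_toReal_iff' (by simp)
        (ENNReal.add_ne_top.2 ⟨ENNReal.div_ne_top (by simp) (by simp),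
          ENNReal.div_ne_top (by simp) (by simp)⟩), ENNReal.toReal_add
          (ENNReal.div_ne_top (by simp) (by simp)) (ENNReal.div_ne_top (by simp) (by simp))]
      norm_num
    rw [h4] at h3
    exact (ENNReal.add_le_add_iff_left (ENNReal.div_ne_top (by simp) (by simp))).1 h3
  have h2 : 2 * L.stopSum P₀ χ ≤
      2 * L.stopSum P₁ ψ + ENNReal.ofReal (4 / 3) / 2 * L.stopSum P₂ (fun _ => 1) := by
    simp only [stopSum, ← ENNReal.tsum_mul_left, ← ENNReal.tsum_add]
    refine ENNReal.tsum_le_tsum fun h => ?_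
    simp only [χ]
    split_ifs with hh
    · have hb : ENNReal.ofReal θ ^ visits x h ≤ ENNReal.ofReal (4 / 3) := by
        rw [← ENNReal.ofReal_pow (by linarith)]
        exact ENNReal.ofReal_le_ofReal ((pow_le_pow_right₀ hθ hh.le).trans hθK)
      have h3 := two_mul_le_of_sq_le (L.reachProb_le_one P₀ h) (L.reachProb_le_one P₁ h)
        (w := ENNReal.ofReal (4 / 3) * L.reachProb P₂ h)
        (ENNReal.mul_ne_top (by simp) (ne_top_of_le_ne_top (by simp) (L.reachProb_le_one P₂ h)))
        ((L.reachProb_sq_le (by linarith) hP h).trans (by rw [mul_assoc]; gcongr))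
      calc 2 * (L.reachProb P₀ h * L.next h none * ψ h)
          = (2 * L.reachProb P₀ h) * (L.next h none * ψ h) := by ring
        _ ≤ (2 * L.reachProb P₁ h + ENNReal.ofReal (4 / 3) * L.reachProb P₂ h / 2) *
            (L.next h none * ψ h) := by gcongr
        _ = 2 * (L.reachProb P₁ h * L.next h none * ψ h) + ENNReal.ofReal (4 / 3) / 2 *
            (L.reachProb P₂ h * L.next h none * ψ h) := by
              simp only [div_eq_mul_inv]; ring
        _ ≤ _ := by gcongr; exact hψ1 h
    · simp
  have h3 := L.stopSum_visits_le P₀ hfin x hK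
  -- The failure probability 1/4 under `P₁` and the bound 4/3 on the powers of θ give 2·(1/4) +
  -- (4/3)/2 = 7/6; the middle event thus has probability at most 7/12, which leaves 5/12.
  have h4 : 2 * L.stopSum P₀ χ ≤ ENNReal.ofReal (7 / 6) := by
    calc 2 * L.stopSum P₀ χ ≤ 2 * (1 / 4) + ENNReal.ofReal (4 / 3) / 2 * 1 := by
          refine h2.trans ?_
          gcongr
          exact L.stopSum_one_le P₂
      _ = ENNReal.ofReal (7 / 6) := by
          rw [show (2 : ℝ≥0∞) = ENNReal.ofReal 2 by simp,
            show (1 / 4 : ℝ≥0∞) = ENNReal.ofReal (1 / 4) by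
              rw [ENNReal.ofReal_div_of_pos (by norm_num)]; simp,
            mul_one, ← ENNReal.ofReal_div_of_pos (by norm_num), ← ENNReal.ofReal_mul (by norm_num),
            ← ENNReal.ofReal_add (by norm_num) (by norm_num)]
          norm_num
  have h5 : L.stopSum P₀ χ ≤ ENNReal.ofReal (7 / 12) := by
    rw [show (7 / 6 : ℝ) = 2 * (7 / 12) by norm_num, ENNReal.ofReal_mul (by norm_num),
      ENNReal.ofReal_ofNat] at h4
    exact (ENNReal.mul_le_mul_iff_right (by simp) (by simp)).1 h4
  have h6 : ENNReal.ofReal (7 / 12) + ENNReal.ofReal (5 / 12) ≤ ENNReal.ofReal (7 / 12) +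
      (L.stopSum P₀ φ + L.expectedVisits P₀ x / K) := by
    rw [← ENNReal.ofReal_add (by norm_num) (by norm_num), show (7 / 12 + 5 / 12 : ℝ) = 1 by norm_num,
      ENNReal.ofReal_one]
    refine h0.trans ?_
    rw [add_comm (L.stopSum P₀ φ), add_assoc]
    gcongr
  exact (ENNReal.add_le_add_iff_left (by simp)).1 h6

end Sampler

end AvgCMDP

namespace AvgCMDP

/-! ### The hard instances: transition law, balance equations and frequencies. -/

section HardInstance

variable {S A : Type} [Fintype S] [DecidableEq S] [DecidableEq A]

/-- The average of `v` over the states other than `y`. -/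
noncomputable def poolAvg (y : S) (v : S → ℝ) : ℝ :=
  ((Fintype.card S : ℝ) - 1)⁻¹ * ∑ s ∈ Finset.univ.erase y, v s

/-- Transition probabilities: the action `a₀` moves from a state other than `y` to a uniformly
chosen state other than `y`, every other action `a` moves from `s ≠ y` to `y` with probability
`ρ s a` and stays otherwise; from `y` the chain moves to a uniformly chosen other state with
probability `ρ y a`. -/
noncomputable def lawFun (y : S) (a₀ : A) (ρ : S → A → ℝ) (s : S) (a : A) (s' : S) : ℝ :=
  if s = y then
    (1 - ρ s a) * (if s' = y then 1 else 0) +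
      ρ s a * (if s' = y then 0 else ((Fintype.card S : ℝ) - 1)⁻¹)
  else if a = a₀ then (if s' = y then 0 else ((Fintype.card S : ℝ) - 1)⁻¹)
  else (1 - ρ s a) * (if s' = s then 1 else 0) + ρ s a * (if s' = y then 1 else 0)

lemma sum_pool_mul (y : S) (v : S → ℝ) :
    ∑ s', (if s' = y then 0 else ((Fintype.card S : ℝ) - 1)⁻¹) * v s' = poolAvg y v := by
  rw [poolAvg, ← Finset.add_sum_erase _ _ (Finset.mem_univ y), Finset.mul_sum, if_pos rfl,
    zero_mul, zero_add]
  refine Finset.sum_congr rfl fun s hs => ?_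
  rw [if_neg (Finset.ne_of_mem_erase hs)]

lemma sum_lawFun_mul (y : S) (a₀ : A) (ρ : S → A → ℝ) (s : S) (a : A) (v : S → ℝ) :
    ∑ s', lawFun y a₀ ρ s a s' * v s' =
      if s = y then (1 - ρ s a) * v y + ρ s a * poolAvg y v
      else if a = a₀ then poolAvg y v else (1 - ρ s a) * v s + ρ s a * v y := by
  unfold lawFun
  split_ifs
  · simp only [add_mul, Finset.sum_add_distrib, mul_assoc, ← Finset.mul_sum, sum_pool_mul]
    simp
  · exact sum_pool_mul y v
  · simp only [add_mul, Finset.sum_add_distrib, mul_assoc, ← Finset.mul_sum]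
    simp

lemma card_erase_eq (y : S) :
    ((Finset.univ.erase y).card : ℝ) = (Fintype.card S : ℝ) - 1 := by
  rw [Finset.card_erase_of_mem (Finset.mem_univ y), Finset.card_univ, Nat.cast_sub, Nat.cast_one]
  exact Fintype.card_pos_iff.2 ⟨y⟩

lemma poolAvg_const (hS : 1 < Fintype.card S) (y : S) (c : ℝ) :
    poolAvg y (fun _ => c) = c := by
  have : (1 : ℝ) < Fintype.card S := by exact_mod_cast hS
  have h : (Fintype.card S : ℝ) - 1 ≠ 0 := by linarith
  rw [poolAvg, Finset.sum_const, nsmul_eq_mul, card_erase_eq]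
  field_simp

lemma lawFun_mem (hS : 1 < Fintype.card S) (y : S) (a₀ : A) {ρ : S → A → ℝ}
    (hρ : ∀ s a, ρ s a ∈ Set.Icc (0 : ℝ) 1) (s : S) (a : A) :
    lawFun y a₀ ρ s a ∈ stdSimplex ℝ S := by
  have hS' : (1 : ℝ) < Fintype.card S := by exact_mod_cast hS
  have h1 : 0 ≤ ((Fintype.card S : ℝ) - 1)⁻¹ := inv_nonneg.2 (by linarith)
  obtain ⟨h2, h3⟩ := hρ s a
  have h3' : 0 ≤ 1 - ρ s a := by linarith
  refine ⟨fun s' => ?_, ?_⟩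
  · unfold lawFun
    split_ifs <;> positivity
  · have := sum_lawFun_mul y a₀ ρ s a (fun _ => 1)
    simp only [mul_one, poolAvg_const hS] at this
    rw [this]
    split_ifs <;> ring

/-- The transition law of the hard instances. -/
noncomputable def law (hS : 1 < Fintype.card S) (y : S) (a₀ : A) (ρ : S → A → ℝ)
    (hρ : ∀ s a, ρ s a ∈ Set.Icc (0 : ℝ) 1) (s : S) (a : A) : stdSimplex ℝ S :=
  ⟨lawFun y a₀ ρ s a, lawFun_mem hS y a₀ hρ s a⟩

/-- The rewards of the hard instances: `fy` in `y`, and elsewhere `fr` for `a₀` and `fh` for all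
other actions. -/
def triReward (y : S) (a₀ : A) (fy fr fh : ℝ) (s : S) (a : A) : ℝ :=
  if s = y then fy else if a = a₀ then fr else fh

variable [Fintype A]

omit [Fintype S] [DecidableEq S] in
lemma sum_erase_policy (π : Policy S A) (s : S) (a₀ : A) :
    ∑ b ∈ Finset.univ.erase a₀, (π s).1 b = 1 - (π s).1 a₀ := by
  rw [← (π s).2.2, ← Finset.add_sum_erase _ _ (Finset.mem_univ a₀)]
  ring

omit [Fintype S] [DecidableEq S] [DecidableEq A] in
lemma policy_le_one (π : Policy S A) (s : S) (a : A) : (π s).1 a ≤ 1 := by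
  rw [← (π s).2.2]
  exact Finset.single_le_sum (fun b _ => (π s).2.1 b) (Finset.mem_univ a)

omit [Fintype S] [DecidableEq S] in
lemma policy_le_one_sub (π : Policy S A) (s : S) {a a₀ : A} (ha : a ≠ a₀) :
    (π s).1 a ≤ 1 - (π s).1 a₀ := by
  rw [← sum_erase_policy]
  exact Finset.single_le_sum (fun b _ => (π s).2.1 b) (Finset.mem_erase.2 ⟨ha, Finset.mem_univ a⟩)

/-- The probability of moving from `s` to `y` in one step. -/
noncomputable def exitProb (a₀ : A) (ρ : S → A → ℝ) (π : Policy S A) (s : S) : ℝ :=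
  ∑ b ∈ Finset.univ.erase a₀, (π s).1 b * ρ s b

lemma sum_policy_law (y : S) (a₀ : A) {ρ : S → A → ℝ} {q : ℝ} (hq : ∀ b, ρ y b = q)
    (π : Policy S A) (s : S) (v : S → ℝ) :
    ∑ b, (π s).1 b * ∑ s', lawFun y a₀ ρ s b s' * v s' =
      if s = y then (1 - q) * v y + q * poolAvg y v
      else (π s).1 a₀ * poolAvg y v + (1 - (π s).1 a₀ - exitProb a₀ ρ π s) * v s +
        exitProb a₀ ρ π s * v y := by
  simp only [sum_lawFun_mul]
  split_ifs with h
  · subst h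
    simp only [hq, ← Finset.sum_mul, (π s).2.2, one_mul]
  · rw [← Finset.add_sum_erase _ _ (Finset.mem_univ a₀), if_pos rfl, add_assoc]
    congr 1
    rw [← sum_erase_policy, exitProb, ← Finset.sum_sub_distrib, Finset.sum_mul, Finset.sum_mul,
      ← Finset.sum_add_distrib]
    refine Finset.sum_congr rfl fun b hb => ?_
    rw [if_neg (Finset.ne_of_mem_erase hb)]
    ring

omit [Fintype S] in
lemma sum_policy_triReward (y : S) (a₀ : A) (fy fr fh : ℝ) (π : Policy S A) (s : S) :
    ∑ b, (π s).1 b * triReward y a₀ fy fr fh s b =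
      if s = y then fy else (π s).1 a₀ * fr + (1 - (π s).1 a₀) * fh := by
  unfold triReward
  split_ifs with h
  · rw [← Finset.sum_mul, (π s).2.2, one_mul]
  · rw [← Finset.add_sum_erase _ _ (Finset.mem_univ a₀), if_pos rfl, ← sum_erase_policy,
      Finset.sum_mul]
    congr 1
    refine Finset.sum_congr rfl fun b hb => ?_
    rw [if_neg (Finset.ne_of_mem_erase hb)]

/-- Balance equations for the hard instances. -/
lemma exists_balance {M : CAMDP S A} {y : S} {a₀ : A} {ρ : S → A → ℝ} {q : ℝ}
    (hM : ∀ s a, (M.P s a).1 = lawFun y a₀ ρ s a) (hq : ∀ b, ρ y b = q) (π : Policy S A) :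
    ∃ (m : S → ℝ) (F : ℝ), (∀ s, 0 ≤ m s) ∧
      (∀ s, s ≠ y → m s * ((π s).1 a₀ + exitProb a₀ ρ π s) = F) ∧
      q * m y = ∑ s ∈ Finset.univ.erase y, m s * exitProb a₀ ρ π s ∧
      m y + ∑ s ∈ Finset.univ.erase y, m s * (1 - (π s).1 a₀) +
        ∑ s ∈ Finset.univ.erase y, m s * (π s).1 a₀ = 1 ∧
      ∀ fy fr fh, M.gain (triReward y a₀ fy fr fh) π =
        fy * m y + fr * ∑ s ∈ Finset.univ.erase y, m s * (π s).1 a₀ +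
          fh * ∑ s ∈ Finset.univ.erase y, m s * (1 - (π s).1 a₀) := by
  obtain ⟨m, h0, h1, h2, h3⟩ := M.exists_stationary π
  simp only [hM, sum_policy_law y a₀ hq] at h2
  have hsplit : ∀ f : S → ℝ, ∑ s, f s = f y + ∑ s ∈ Finset.univ.erase y, f s :=
    fun f => (Finset.add_sum_erase _ _ (Finset.mem_univ y)).symm
  have hoff : ∀ (f g : S → ℝ), ∑ s ∈ Finset.univ.erase y, (if s = y then f s else g s) =
      ∑ s ∈ Finset.univ.erase y, g s := fun f g =>
    Finset.sum_congr rfl fun s hs => if_neg (Finset.ne_of_mem_erase hs)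
  refine ⟨m, ((Fintype.card S : ℝ) - 1)⁻¹ *
    (q * m y + ∑ s ∈ Finset.univ.erase y, m s * (π s).1 a₀), h0, fun s₀ hs₀ => ?_, ?_, ?_, ?_⟩
  -- Stationarity tested on the indicator of a pool state: outflow equals the inflow through the
  -- uniform redraw, which is the same for every pool state.
  · have h := h2 (Pi.single s₀ 1)
    have hp : poolAvg y (Pi.single s₀ 1) = ((Fintype.card S : ℝ) - 1)⁻¹ := by
      rw [poolAvg]
      simp [Pi.single_apply, hs₀]
    rw [hsplit, if_pos rfl] at h
    simp only [mul_ite, hoff, hp, Pi.single_eq_of_ne hs₀.symm, mul_zero, add_zero, zero_add,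
      mul_add, Finset.sum_add_distrib] at h
    have e1 : ∑ s ∈ Finset.univ.erase y, m s * ((1 - (π s).1 a₀ - exitProb a₀ ρ π s) *
        (Pi.single s₀ (1 : ℝ) : S → ℝ) s) = m s₀ * (1 - (π s₀).1 a₀ - exitProb a₀ ρ π s₀) := by
      rw [Finset.sum_eq_single_of_mem s₀ (Finset.mem_erase.2 ⟨hs₀, Finset.mem_univ _⟩)]
      · simp
      · intro b _ hb
        simp [Pi.single_eq_of_ne hb]
    have e2 : ∑ s, m s * (Pi.single s₀ (1 : ℝ) : S → ℝ) s = m s₀ := by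
      rw [Finset.sum_eq_single_of_mem s₀ (Finset.mem_univ _)]
      · simp
      · intro b _ hb
        simp [Pi.single_eq_of_ne hb]
    rw [e1, e2] at h
    simp only [← mul_assoc, ← Finset.sum_mul] at h
    linarith
  -- Stationarity tested on the indicator of `y`: outflow equals inflow from the pool.
  · have h := h2 (Pi.single y 1)
    have hp : poolAvg y (Pi.single y 1) = 0 := by
      rw [poolAvg]
      simp [Pi.single_apply]
    rw [hsplit, if_pos rfl, hsplit (fun s => m s * (Pi.single y (1 : ℝ) : S → ℝ) s)] at h
    simp only [mul_ite, hoff, hp, Pi.single_eq_same, mul_zero, add_zero, zero_add, mul_one,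
      mul_add, Finset.sum_add_distrib] at h
    have e1 : ∀ g : S → ℝ, ∑ s ∈ Finset.univ.erase y, m s * (g s *
        (Pi.single y (1 : ℝ) : S → ℝ) s) = 0 := fun g =>
      Finset.sum_eq_zero fun s hs => by simp [Pi.single_eq_of_ne (Finset.ne_of_mem_erase hs)]
    have e2 : ∑ s ∈ Finset.univ.erase y, m s * (Pi.single y (1 : ℝ) : S → ℝ) s = 0 :=
      Finset.sum_eq_zero fun s hs => by simp [Pi.single_eq_of_ne (Finset.ne_of_mem_erase hs)]
    rw [e1, e2] at h
    linarith
  · refine Eq.trans ?_ h1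
    rw [hsplit m, add_assoc, ← Finset.sum_add_distrib]
    congr 1
    refine Finset.sum_congr rfl fun s _ => by ring
  · intro fy fr fh
    rw [h3]
    simp only [sum_policy_triReward]
    rw [hsplit, if_pos rfl]
    simp only [mul_ite, hoff, mul_add, Finset.sum_add_distrib, Finset.mul_sum]
    rw [mul_comm (m y), add_assoc]
    congr 2 <;> exact Finset.sum_congr rfl fun s _ => by ring

/-- The parameter `p` everywhere except for the value `p'` at one state-action pair. -/
noncomputable def bump (i : S) (a : A) (p p' : ℝ) (s : S) (b : A) : ℝ :=
  if s = i ∧ b = a then p' else p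

omit [Fintype S] in
lemma exitProb_bump {i : S} {a a₀ : A} (ha : a ≠ a₀) (p δ : ℝ) (π : Policy S A) (s : S) :
    exitProb a₀ (bump i a p (p * (1 + δ))) π s =
      p * (1 - (π s).1 a₀) + if s = i then p * δ * (π i).1 a else 0 := by
  have h : ∀ b, (π s).1 b * bump i a p (p * (1 + δ)) s b =
      p * (π s).1 b + if b = a then (if s = i then p * δ * (π i).1 a else 0) else 0 := by
    intro b
    unfold bump
    by_cases h1 : s = i <;> by_cases h2 : b = a <;> simp [h1, h2]
    · ring
    · ring
    · ring
    · ring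
  simp only [exitProb, h, Finset.sum_add_distrib, ← Finset.mul_sum, sum_erase_policy,
    Finset.sum_ite_eq', Finset.mem_erase, Finset.mem_univ, and_true, if_pos ha]

/-- The policies which, in the unperturbed instance, play the pair `(i, a)` in more than half of
the time that they spend in states other than `y` playing actions other than `a₀`. -/
def concentrated (y : S) (a₀ : A) (p : ℝ) (i : S) (a : A) : Set (Policy S A) :=
  {π | ∑ s ∈ Finset.univ.erase y, (1 - (π s).1 a₀) / ((π s).1 a₀ + p * (1 - (π s).1 a₀)) <
    2 * ((π i).1 a / ((π i).1 a₀ + p * (1 - (π i).1 a₀)))}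

omit [Fintype S] [DecidableEq S] [DecidableEq A] in
lemma measurable_policy (s : S) (a : A) : Measurable fun π : Policy S A => (π s).1 a :=
  (measurable_pi_apply a).comp (measurable_subtype_coe.comp (measurable_pi_apply s))

omit [DecidableEq A] in
-- The change of measure and the sum over disjoint events need measurable sets; sets of near-optimal
-- policies enter only by inclusion in these.
lemma measurableSet_concentrated (y : S) (a₀ : A) (p : ℝ) (i : S) (a : A) :
    MeasurableSet (concentrated y a₀ p i a) := by
  have h := fun (s : S) (a : A) => measurable_policy s a
  refine measurableSet_lt (Finset.measurable_sum _ fun s _ => ?_) (Measurable.const_mul ?_ _)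
  · exact (measurable_const.sub (h s a₀)).div
      ((h s a₀).add ((measurable_const.sub (h s a₀)).const_mul p))
  · exact (h i a).div ((h i a₀).add ((measurable_const.sub (h i a₀)).const_mul p))

omit [Fintype S] [DecidableEq S] [DecidableEq A] in
lemma rate_pos {p : ℝ} (hp : 0 < p) (hp1 : p ≤ 1) (π : Policy S A) (s : S) (a₀ : A) :
    0 < (π s).1 a₀ + p * (1 - (π s).1 a₀) ∧ p ≤ (π s).1 a₀ + p * (1 - (π s).1 a₀) := by
  have h0 := (π s).2.1 a₀
  have : p ≤ (π s).1 a₀ + p * (1 - (π s).1 a₀) := by nlinarith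
  exact ⟨by linarith, this⟩

lemma disjoint_concentrated {y : S} {a₀ : A} {p : ℝ} (hp : 0 < p) (hp1 : p ≤ 1) {i j : S}
    {a b : A} (hi : i ≠ y) (hj : j ≠ y) (ha : a ≠ a₀) (hb : b ≠ a₀) (hne : (i, a) ≠ (j, b)) :
    Disjoint (concentrated y a₀ p i a) (concentrated y a₀ p j b) := by
  rw [Set.disjoint_left]
  intro π h1 h2
  simp only [concentrated, Set.mem_ofPred_eq] at h1 h2
  set f : S → ℝ := fun s => (1 - (π s).1 a₀) / ((π s).1 a₀ + p * (1 - (π s).1 a₀))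
  have hf : ∀ s, 0 ≤ f s := fun s =>
    div_nonneg (by linarith [policy_le_one π s a₀]) (rate_pos hp hp1 π s a₀).1.le
  -- Distinct pairs have a joint share of at most the whole, so each cannot exceed half.
  suffices h : (π i).1 a / ((π i).1 a₀ + p * (1 - (π i).1 a₀)) +
      (π j).1 b / ((π j).1 a₀ + p * (1 - (π j).1 a₀)) ≤ ∑ s ∈ Finset.univ.erase y, f s by
    linarith
  by_cases hij : i = j
  · subst hij
    have hab : a ≠ b := fun h => hne (by rw [h])
    refine le_trans ?_ (Finset.single_le_sum (fun s _ => hf s)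
      (Finset.mem_erase.2 ⟨hi, Finset.mem_univ _⟩))
    rw [← add_div]
    refine div_le_div_of_nonneg_right ?_ (rate_pos hp hp1 π i a₀).1.le
    rw [← sum_erase_policy, ← Finset.sum_pair (f := fun b => (π i).1 b) hab]
    refine Finset.sum_le_sum_of_subset_of_nonneg (fun c hc => ?_) fun c _ _ => (π i).2.1 c
    simp only [Finset.mem_insert, Finset.mem_singleton] at hc
    rcases hc with rfl | rfl <;> simp [*]
  · refine le_trans (add_le_add
      (div_le_div_of_nonneg_right (policy_le_one_sub π i ha) (rate_pos hp hp1 π i a₀).1.le)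
      (div_le_div_of_nonneg_right (policy_le_one_sub π j hb) (rate_pos hp hp1 π j a₀).1.le)) ?_
    have := Finset.sum_pair (f := f) hij
    refine this.ge.trans ?_
    refine Finset.sum_le_sum_of_subset_of_nonneg (fun c hc => ?_) fun c _ _ => hf c
    simp only [Finset.mem_insert, Finset.mem_singleton] at hc
    rcases hc with rfl | rfl <;> simp [*]

/-- Occupation frequencies in a perturbed instance: `X` of the perturbed pair, `H` of the actions
other than `a₀` in states other than `y`, `R` of the action `a₀` in states other than `y`. -/
lemma exists_frequencies {M : CAMDP S A} {y i : S} {a₀ a : A} {p δ : ℝ}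
    (hM : ∀ s b, (M.P s b).1 = lawFun y a₀ (bump i a p (p * (1 + δ))) s b)
    (hi : i ≠ y) (ha : a ≠ a₀) (hp : 0 < p) (hp1 : p ≤ 1) (hδ : 0 ≤ δ) (hδ1 : δ ≤ 1 / 10)
    (π : Policy S A) :
    ∃ X H R : ℝ, 0 ≤ X ∧ X ≤ H ∧ 0 ≤ R ∧ 2 * H + δ * X + R = 1 ∧
      (∀ fy fr fh, M.gain (triReward y a₀ fy fr fh) π = fy * (H + δ * X) + fr * R + fh * H) ∧
      (0 < X → 3 / 5 * H ≤ X → π ∈ concentrated y a₀ p i a) := by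
  have hq : ∀ b, bump i a p (p * (1 + δ)) y b = p := fun b => if_neg fun h => hi h.1.symm
  obtain ⟨m, F, h0, h1, h2, h3, h4⟩ := exists_balance hM hq π
  simp only [exitProb_bump ha] at h1 h2
  set H := ∑ s ∈ Finset.univ.erase y, m s * (1 - (π s).1 a₀)
  set R := ∑ s ∈ Finset.univ.erase y, m s * (π s).1 a₀
  have him : i ∈ Finset.univ.erase y := Finset.mem_erase.2 ⟨hi, Finset.mem_univ _⟩
  have hW : ∀ s, 0 ≤ 1 - (π s).1 a₀ := fun s => by linarith [policy_le_one π s a₀]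
  have hY : m y = H + δ * (m i * (π i).1 a) := by
    have : p * m y = p * (H + δ * (m i * (π i).1 a)) := by
      rw [h2]
      simp only [mul_add, mul_ite, mul_zero, Finset.sum_add_distrib, Finset.sum_ite_eq', if_pos him,
        H, Finset.mul_sum]
      congr 1
      · exact Finset.sum_congr rfl fun s _ => by ring
      · ring
    exact mul_left_cancel₀ hp.ne' this
  refine ⟨m i * (π i).1 a, H, R, mul_nonneg (h0 i) ((π i).2.1 a), ?_,
    Finset.sum_nonneg fun s _ => mul_nonneg (h0 s) ((π s).2.1 a₀), by linarith, ?_, ?_⟩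
  · exact (mul_le_mul_of_nonneg_left (policy_le_one_sub π i ha) (h0 i)).trans
      (Finset.single_le_sum (f := fun s => m s * (1 - (π s).1 a₀))
        (fun s _ => mul_nonneg (h0 s) (hW s)) him)
  · intro fy fr fh
    rw [h4, hY]
  · intro hX hXH
    simp only [concentrated, Set.mem_ofPred_eq]
    set f : S → ℝ := fun s => (1 - (π s).1 a₀) / ((π s).1 a₀ + p * (1 - (π s).1 a₀))
    set D : S → ℝ := fun s => (π s).1 a₀ + p * (1 - (π s).1 a₀)
    have hD : ∀ s, 0 < D s := fun s => (rate_pos hp hp1 π s a₀).1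
    have hai := (π i).2.1 a
    have hle := policy_le_one_sub π i ha
    have hmi : 0 < m i := by
      rcases (h0 i).eq_or_lt with h | h
      · rw [← h, zero_mul] at hX; exact absurd hX (lt_irrefl _)
      · exact h
    have hFi := h1 i hi
    rw [if_pos rfl] at hFi
    -- Without perturbation `m s * D s` would equal `F` throughout the pool. At `i` it is off by a
    -- factor of at most 1 + δ, so shares computed here and in the unperturbed instance differ by at
    -- most that factor.
    have hFi1 : m i * D i ≤ F := by
      rw [← hFi]
      refine mul_le_mul_of_nonneg_left ?_ hmi.le
      have : 0 ≤ p * δ * (π i).1 a := by positivity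
      simp only [D]; linarith
    have hF : 0 < F := (mul_pos hmi (hD i)).trans_le hFi1
    have hFi2 : F ≤ m i * D i * (1 + δ) := by
      have h5 : p * δ * (π i).1 a ≤ δ * D i := by
        have h6 : p * (π i).1 a ≤ D i := by
          have := mul_le_mul_of_nonneg_left hle hp.le
          have := (π i).2.1 a₀
          simp only [D]; linarith
        nlinarith
      rw [← hFi, mul_assoc (m i)]
      refine mul_le_mul_of_nonneg_left ?_ hmi.le
      simp only [D] at h5 ⊢
      linarith
    have hlow : ∀ s ∈ Finset.univ.erase y, F / (1 + δ) * f s ≤ m s * (1 - (π s).1 a₀) := by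
      intro s hs
      have h5 : F / (1 + δ) ≤ m s * D s := by
        rw [div_le_iff₀ (by linarith)]
        by_cases hsi : s = i
        · rw [hsi]; exact hFi2
        · have h6 := h1 s (Finset.ne_of_mem_erase hs)
          rw [if_neg hsi, add_zero] at h6
          have h7 : m s * D s = F := h6
          rw [h7]
          nlinarith
      calc F / (1 + δ) * f s ≤ m s * D s * f s :=
            mul_le_mul_of_nonneg_right h5 (div_nonneg (hW s) (hD s).le)
        _ = m s * (1 - (π s).1 a₀) := by
            have := (hD s).ne'
            simp only [f]
            change m s * D s * ((1 - (π s).1 a₀) / D s) = _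
            field_simp
    have hH : F / (1 + δ) * ∑ s ∈ Finset.univ.erase y, f s ≤ H := by
      rw [Finset.mul_sum]
      exact Finset.sum_le_sum hlow
    have hX2 : m i * (π i).1 a ≤ F * ((π i).1 a / D i) := by
      rw [mul_div_assoc', le_div_iff₀ (hD i)]
      nlinarith
    have h8 : F / (1 + δ) * (∑ s ∈ Finset.univ.erase y, f s) * (3 / 5) ≤
        F * ((π i).1 a / D i) := by linarith
    have h9 : (∑ s ∈ Finset.univ.erase y, f s) * (3 / 5) ≤ (1 + δ) * ((π i).1 a / D i) := by
      have : F / (1 + δ) * (∑ s ∈ Finset.univ.erase y, f s) * (3 / 5) =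
        F * ((∑ s ∈ Finset.univ.erase y, f s) * (3 / 5) / (1 + δ)) := by ring
      rw [this, mul_le_mul_iff_right₀ hF, div_le_iff₀ (by linarith)] at h8
      linarith
    -- The share 3/5 leaves room for the distortion: (5/3)(1 + δ) ≤ 11/6 < 2, and positivity makes
    -- the inequality strict.
    have h10 : 0 < (π i).1 a / D i := by
      refine div_pos (hai.lt_of_ne fun h => ?_) (hD i)
      rw [← h, mul_zero] at hX
      exact lt_irrefl _ hX
    change _ < 2 * ((π i).1 a / D i)
    nlinarith

/-- The policy which plays `a` with probability `1 / (1 + t)` in state `i` and `a₀` otherwise. -/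
noncomputable def mixPolicy (i : S) (a a₀ : A) (t : ℝ) (ht : 0 ≤ t) : Policy S A := fun s =>
  if s = i then
    ⟨(1 / (1 + t)) • Pi.single a 1 + (t / (1 + t)) • Pi.single a₀ 1,
      convex_stdSimplex ℝ A (single_mem_stdSimplex ℝ a) (single_mem_stdSimplex ℝ a₀)
        (by positivity) (by positivity) (by field_simp)⟩
  else ⟨Pi.single a₀ 1, single_mem_stdSimplex ℝ a₀⟩

/-- Frequencies of the policy `mixPolicy` in a perturbed instance. -/
lemma exists_frequencies_mixPolicy {M : CAMDP S A} {y i : S} {a₀ a : A} {p δ : ℝ}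
    (hM : ∀ s b, (M.P s b).1 = lawFun y a₀ (bump i a p (p * (1 + δ))) s b)
    (hi : i ≠ y) (ha : a ≠ a₀) (hp : 0 < p) {t : ℝ} (ht : 0 ≤ t) :
    ∃ X R : ℝ, R = ((Fintype.card S : ℝ) - 2) * (t + p * (1 + δ)) + t ∧
      X * (2 + δ + R) = 1 ∧
      (∀ fy fr fh, M.gain (triReward y a₀ fy fr fh) (mixPolicy i a a₀ t ht) =
        X * ((1 + δ) * fy + R * fr + fh)) := by
  have hq : ∀ b, bump i a p (p * (1 + δ)) y b = p := fun b => if_neg fun h => hi h.1.symm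
  set π := mixPolicy i a a₀ t ht
  obtain ⟨m, F, h0, h1, h2, h3, h4⟩ := exists_balance hM hq π
  simp only [exitProb_bump ha] at h1 h2
  have ht1 : 1 + t ≠ 0 := by positivity
  have hiW : (π i).1 a₀ = t / (1 + t) := by
    simp [π, mixPolicy, Pi.single_eq_of_ne ha.symm]
  have hia : (π i).1 a = 1 / (1 + t) := by
    simp [π, mixPolicy, Pi.single_eq_of_ne ha]
  have hsW : ∀ s, s ≠ i → (π s).1 a₀ = 1 := fun s hs => by simp [π, mixPolicy, hs]
  have him : i ∈ Finset.univ.erase y := Finset.mem_erase.2 ⟨hi, Finset.mem_univ _⟩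
  have hsplit : ∀ f : S → ℝ, ∑ s ∈ Finset.univ.erase y, f s =
      f i + ∑ s ∈ (Finset.univ.erase y).erase i, f s :=
    fun f => (Finset.add_sum_erase _ _ him).symm
  have hFi := h1 i hi
  rw [if_pos rfl, hiW, hia] at hFi
  set X := m i / (1 + t) with hX
  have hmi : m i = X * (1 + t) := by rw [hX]; field_simp
  have hF : F = X * (t + p * (1 + δ)) := by
    rw [← hFi, hmi]; field_simp; ring
  have hms : ∀ s ∈ (Finset.univ.erase y).erase i, m s = F := by
    intro s hs
    have hsi := Finset.ne_of_mem_erase hs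
    have h5 := h1 s (Finset.ne_of_mem_erase (Finset.mem_of_mem_erase hs))
    rw [hsW s hsi, if_neg hsi] at h5
    linarith
  have hcard : (((Finset.univ.erase y).erase i).card : ℝ) = (Fintype.card S : ℝ) - 2 := by
    have h5 : ((Finset.univ.erase y).erase i).card + 1 = (Finset.univ.erase y).card :=
      Finset.card_erase_add_one him
    have h6 := card_erase_eq y
    rw [← h5] at h6
    push_cast at h6
    linarith
  have hH : ∑ s ∈ Finset.univ.erase y, m s * (1 - (π s).1 a₀) = X := by
    rw [hsplit, Finset.sum_eq_zero, add_zero, hiW, hmi]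
    · field_simp; ring
    · intro s hs
      rw [hsW s (Finset.ne_of_mem_erase hs), sub_self, mul_zero]
  have hR : ∑ s ∈ Finset.univ.erase y, m s * (π s).1 a₀ =
      X * (((Fintype.card S : ℝ) - 2) * (t + p * (1 + δ)) + t) := by
    have h5 : ∑ s ∈ (Finset.univ.erase y).erase i, m s * (π s).1 a₀ =
        ((Fintype.card S : ℝ) - 2) * F := by
      rw [← hcard, ← nsmul_eq_mul, ← Finset.sum_const]
      refine Finset.sum_congr rfl fun s hs => ?_
      rw [hsW s (Finset.ne_of_mem_erase hs), mul_one, hms s hs]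
    rw [hsplit, h5, hiW, hmi, hF]
    field_simp
    ring
  have hY : m y = (1 + δ) * X := by
    have : p * m y = p * ((1 + δ) * X) := by
      rw [h2, hsplit, Finset.sum_eq_zero, add_zero, if_pos rfl, hiW, hia, hmi]
      · field_simp; ring
      · intro s hs
        have hsi := Finset.ne_of_mem_erase hs
        rw [hsW s hsi, if_neg hsi, sub_self, mul_zero, add_zero, mul_zero]
    exact mul_left_cancel₀ hp.ne' this
  refine ⟨X, _, rfl, ?_, fun fy fr fh => ?_⟩
  · rw [hH, hR, hY] at h3
    linear_combination h3
  · rw [h4, hH, hR, hY]; ring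

/-! ### Diameter, communication and bias span of the hard instances. -/

section Structure

variable {M : CAMDP S A} {y : S} {a₀ : A} {ρ : S → A → ℝ} {p : ℝ}

lemma chain_mulVec_of_law (hM : ∀ s a, (M.P s a).1 = lawFun y a₀ ρ s a) (hq : ∀ b, ρ y b = p)
    (π : Policy S A) (v : S → ℝ) (s : S) :
    (M.chain π *ᵥ v) s = if s = y then (1 - p) * v y + p * poolAvg y v
      else (π s).1 a₀ * poolAvg y v + (1 - (π s).1 a₀ - exitProb a₀ ρ π s) * v s +
        exitProb a₀ ρ π s * v y := by
  rw [CAMDP.chain_mulVec]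
  simp only [hM]
  exact sum_policy_law y a₀ hq π s v

omit [Fintype S] [DecidableEq S] in
lemma exitProb_ofDet (ρ : S → A → ℝ) (d : S → A) (s : S) :
    exitProb a₀ ρ (Policy.ofDet d) s = if d s = a₀ then 0 else ρ s (d s) := by
  rw [exitProb]
  simp only [Policy.ofDet, Pi.single_apply, ite_mul, one_mul, zero_mul, Finset.sum_ite_eq',
    Finset.mem_erase, Finset.mem_univ, and_true]
  split_ifs <;> simp_all

/-- Towards `y`, always playing `a₁` succeeds with probability at least p per step. Towards a pool
state, always playing `a₀` is a geometric trial with success probability 1/(S−1), after a wait of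
mean 1/p if started in `y`. -/
lemma diameter_le_of_law (hS : 1 < Fintype.card S)
    (hM : ∀ s a, (M.P s a).1 = lawFun y a₀ ρ s a) (hq : ∀ b, ρ y b = p) (hp : 0 < p)
    (hρ : ∀ s a, p ≤ ρ s a) {a₁ : A} (ha₁ : a₁ ≠ a₀) :
    M.diameter ≤ ENNReal.ofReal ((Fintype.card S : ℝ) - 1 + 1 / p) := by
  have hS' : (1 : ℝ) < Fintype.card S := by exact_mod_cast hS
  have hn : 0 < (Fintype.card S : ℝ) - 1 := by linarith
  rw [CAMDP.diameter]
  refine iSup_le fun s => iSup_le fun g => iSup_le fun _ => ?_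
  by_cases hg : g = y
  · subst hg
    refine (iInf_le _ (Policy.ofDet fun _ => a₁)).trans
      ((M.hittingTime_le _ g (V := fun s => if s = g then 0 else 1 / p) ?_ ?_ s).trans ?_)
    · intro s; split_ifs <;> positivity
    · intro s hs
      rw [chain_mulVec_of_law hM hq, exitProb_ofDet, if_neg hs, if_neg ha₁]
      simp only [Policy.ofDet, Pi.single_eq_of_ne ha₁.symm, if_true, if_neg hs]
      have h1 := hρ s a₁
      have h2 : 1 ≤ ρ s a₁ * (1 / p) := by
        rw [mul_one_div, le_div_iff₀ hp]; linarith
      linarith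
    · refine ENNReal.ofReal_le_ofReal ?_
      have : 0 < 1 / p := by positivity
      split_ifs <;> linarith
  · have hgm : g ∈ Finset.univ.erase y := Finset.mem_erase.2 ⟨hg, Finset.mem_univ _⟩
    set V : S → ℝ := fun s => if s = y then (Fintype.card S : ℝ) - 1 + 1 / p else
      if s = g then 0 else (Fintype.card S : ℝ) - 1
    have hV : poolAvg y V = (Fintype.card S : ℝ) - 1 - 1 := by
      have h1 : ∑ s ∈ Finset.univ.erase y, V s = ((Fintype.card S : ℝ) - 1) *
          ((Fintype.card S : ℝ) - 1 - 1) := by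
        rw [← Finset.add_sum_erase _ _ hgm]
        have h2 : ∑ s ∈ (Finset.univ.erase y).erase g, V s =
            ∑ s ∈ (Finset.univ.erase y).erase g, ((Fintype.card S : ℝ) - 1) := by
          refine Finset.sum_congr rfl fun s hs => ?_
          simp only [V]
          rw [if_neg (Finset.ne_of_mem_erase (Finset.mem_of_mem_erase hs)),
            if_neg (Finset.ne_of_mem_erase hs)]
        have h5 := Finset.card_erase_add_one hgm
        have h6 := card_erase_eq y
        rw [← h5] at h6
        push_cast at h6
        rw [h2, Finset.sum_const, nsmul_eq_mul, ← h6]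
        simp [V, hg]
        ring
      rw [poolAvg, h1, ← mul_assoc, inv_mul_cancel₀ hn.ne', one_mul]
    have hpp : 0 < 1 / p := by positivity
    refine (iInf_le _ (Policy.ofDet fun _ => a₀)).trans
      ((M.hittingTime_le _ g (V := V) ?_ ?_ s).trans ?_)
    · intro s; simp only [V]; split_ifs <;> positivity
    · intro s hs
      rw [chain_mulVec_of_law hM hq, exitProb_ofDet, if_pos rfl, hV]
      simp only [Policy.ofDet, Pi.single_eq_same, V, if_neg hs, if_true]
      split_ifs with h
      · have : p * (1 / p) = 1 := by field_simp
        nlinarith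
      · linarith
    · refine ENNReal.ofReal_le_ofReal ?_
      simp only [V]
      split_ifs <;> linarith

lemma isCommunicating_of_law (hS : 1 < Fintype.card S)
    (hM : ∀ s a, (M.P s a).1 = lawFun y a₀ ρ s a) (hp : 0 < p)
    (hρ : ∀ s a, p ≤ ρ s a) {a₁ : A} (ha₁ : a₁ ≠ a₀) : M.IsCommunicating := by
  have hS' : (1 : ℝ) < Fintype.card S := by exact_mod_cast hS
  have hn : 0 < ((Fintype.card S : ℝ) - 1)⁻¹ := inv_pos.2 (by linarith)
  have hdet : ∀ (b : A) s s', M.chain (Policy.ofDet fun _ => b) s s' = lawFun y a₀ ρ s b s' := by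
    intro b s s'
    simp [CAMDP.chain, Policy.ofDet, Pi.single_apply, hM]
  intro s s'
  by_cases hss : s = s'
  · exact ⟨Policy.ofDet fun _ => a₀, 0, by simp [hss]⟩
  by_cases hs' : s' = y
  · refine ⟨Policy.ofDet fun _ => a₁, 1, ?_⟩
    have h : s ≠ y := fun h => hss (h.trans hs'.symm)
    rw [pow_one, hdet, lawFun, if_neg h, if_neg ha₁, if_neg (Ne.symm hss), if_pos hs']
    linarith [hρ s a₁]
  · refine ⟨Policy.ofDet fun _ => a₀, 1, ?_⟩
    rw [pow_one, hdet, lawFun]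
    simp only [if_neg hs', if_true]
    split_ifs with h
    · rw [mul_zero, zero_add]; exact mul_pos (hp.trans_le (hρ s a₀)) hn
    · exact hn

/-- In the unperturbed instance all bias functions are of order `1 / p`. -/
lemma abs_bias_le_of_law (hS : 1 < Fintype.card S)
    (hM : ∀ s a, (M.P s a).1 = lawFun y a₀ (fun _ _ => p) s a) (hp : 0 < p) (hp1 : p ≤ 1)
    {fy fr fh : ℝ} (hy : fy ∈ Set.Icc (0 : ℝ) 1) (hr : fr ∈ Set.Icc (0 : ℝ) 1)
    (hh : fh ∈ Set.Icc (0 : ℝ) 1) (π : Policy S A) (s : S) :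
    |M.bias (triReward y a₀ fy fr fh) π s| ≤ 4 / p := by
  obtain ⟨hy0, hy1⟩ := hy
  obtain ⟨hr0, hr1⟩ := hr
  obtain ⟨hh0, hh1⟩ := hh
  set W : S → ℝ := fun s => (π s).1 a₀
  have hW0 : ∀ s, 0 ≤ W s := fun s => (π s).2.1 a₀
  have hW1 : ∀ s, W s ≤ 1 := fun s => policy_le_one π s a₀
  set D : S → ℝ := fun s => W s + p * (1 - W s)
  have hD : ∀ s, 0 < D s ∧ p ≤ D s := fun s => rate_pos hp hp1 π s a₀
  set u : S → ℝ := fun s => W s * fr + (1 - W s) * (fh + fy)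
  have hu0 : ∀ s, 0 ≤ u s := fun s => by
    have := hW0 s; have : 0 ≤ 1 - W s := by linarith [hW1 s]
    simp only [u]; positivity
  have hu2 : ∀ s, u s ≤ 2 - W s := fun s => by
    have := hW0 s; have h2 : 0 ≤ 1 - W s := by linarith [hW1 s]
    simp only [u]; nlinarith
  set N := ∑ s ∈ Finset.univ.erase y, u s / D s
  set G := ∑ s ∈ Finset.univ.erase y, (2 - W s) / D s
  have hne : (Finset.univ.erase y).Nonempty := by
    rw [← Finset.card_pos, Finset.card_erase_of_mem (Finset.mem_univ y), Finset.card_univ]; omega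
  have hG : 0 < G := Finset.sum_pos (fun s _ => div_pos (by linarith [hW1 s]) (hD s).1) hne
  have hN0 : 0 ≤ N := Finset.sum_nonneg fun s _ => div_nonneg (hu0 s) (hD s).1.le
  have hNG : N ≤ G :=
    Finset.sum_le_sum fun s _ => div_le_div_of_nonneg_right (hu2 s) (hD s).1.le
  set g := N / G
  have hg0 : 0 ≤ g := div_nonneg hN0 hG.le
  have hg1 : g ≤ 1 := div_le_one_of_le₀ hNG hG.le
  -- The chain regenerates at each draw from the pool. From a pool state `s` the mean reward and the
  -- mean time up to the next draw are `u s / D s` and `(2 - W s) / D s`; `h` is the excess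
  -- collected meanwhile, and `g`, a ratio of cycle totals, makes its pool average vanish.
  set h : S → ℝ := fun s => if s = y then (fy - g) / p else (u s - g * (2 - W s)) / D s
  have hpool : poolAvg y h = 0 := by
    have : ∑ s ∈ Finset.univ.erase y, h s = N - g * G := by
      simp only [N, G, Finset.mul_sum, ← Finset.sum_sub_distrib]
      refine Finset.sum_congr rfl fun s hs => ?_
      simp only [h, if_neg (Finset.ne_of_mem_erase hs)]
      ring
    rw [poolAvg, this]
    simp only [g]
    rw [div_mul_cancel₀ _ hG.ne', sub_self, mul_zero]
  have hB : ∀ s, |h s| ≤ 2 / p := by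
    intro s
    simp only [h]
    split_ifs
    · rw [abs_div, abs_of_pos hp]
      refine div_le_div_of_nonneg_right (abs_le.2 ⟨by linarith, by linarith⟩) hp.le
    · rw [abs_div, abs_of_pos (hD s).1]
      refine div_le_div₀ (by norm_num) ?_ hp (hD s).2
      have h1 := hu0 s; have h2 := hu2 s; have h3 := hW0 s; have h4 := hW1 s
      have h5 : 0 ≤ g * (2 - W s) := mul_nonneg hg0 (by linarith)
      have h6 : g * (2 - W s) ≤ 2 - W s := mul_le_of_le_one_left (by linarith) hg1
      exact abs_le.2 ⟨by linarith, by linarith⟩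
  have hexit : ∀ s, exitProb a₀ (fun _ _ => p) π s = p * (1 - W s) := by
    intro s
    rw [exitProb, ← Finset.sum_mul, sum_erase_policy, mul_comm]
  have := M.abs_bias_le (triReward y a₀ fy fr fh) π (g := g) hB ?_ s
  · refine this.trans (le_of_eq ?_)
    ring
  · intro s
    rw [chain_mulVec_of_law hM (fun _ => rfl), sum_policy_triReward, hpool, hexit]
    by_cases hs : s = y
    · simp only [hs, h, if_true]
      field_simp
      ring
    · simp only [hs, h, if_true, if_false]
      have h1 := (hD s).1.ne'
      have h2 : (u s - g * (2 - W s)) / D s * D s = u s - g * (2 - W s) := div_mul_cancel₀ _ h1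
      have h3 : (fy - g) / p * p = fy - g := div_mul_cancel₀ _ hp.ne'
      simp only [u] at h2 ⊢
      set z := (W s * fr + (1 - W s) * (fh + fy) - g * (2 - W s)) / D s
      simp only [D] at h2
      set x := (fy - g) / p
      change W s * fr + (1 - W s) * fh = g + (z - (W s * 0 + (1 - W s - p * (1 - W s)) * z +
        p * (1 - W s) * x))
      linear_combination (-1) * h2 + (1 - W s) * h3

lemma biasSpan_le_of_law (hS : 1 < Fintype.card S)
    (hM : ∀ s a, (M.P s a).1 = lawFun y a₀ (fun _ _ => p) s a) (hp : 0 < p) (hp1 : p ≤ 1)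
    {fy fr fh gy gr gh : ℝ} (hfy : fy ∈ Set.Icc (0 : ℝ) 1) (hfr : fr ∈ Set.Icc (0 : ℝ) 1)
    (hfh : fh ∈ Set.Icc (0 : ℝ) 1) (hgy : gy ∈ Set.Icc (0 : ℝ) 1)
    (hgr : gr ∈ Set.Icc (0 : ℝ) 1) (hgh : gh ∈ Set.Icc (0 : ℝ) 1)
    (hr : M.r = triReward y a₀ fy fr fh) (hc : M.c = triReward y a₀ gy gr gh) :
    M.biasSpan ≤ 8 / p := by
  have : Nonempty S := ⟨y⟩
  have : Nonempty A := ⟨a₀⟩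
  have h8 : 8 / p = 2 * (4 / p) := by ring
  rw [CAMDP.biasSpan, hr, hc, h8]
  exact max_le
    (ciSup_le fun d => CAMDP.spanNorm_le fun s => abs_bias_le_of_law hS hM hp hp1 hfy hfr hfh _ s)
    (ciSup_le fun d => CAMDP.spanNorm_le fun s => abs_bias_le_of_law hS hM hp hp1 hgy hgr hgh _ s)

end Structure

end HardInstance

end AvgCMDP

namespace AvgCMDP

/-! ### Near-optimal policies concentrate on the perturbed pair. -/

section NearOptimal

variable {S A : Type} [Fintype S] [DecidableEq S] [DecidableEq A] [Fintype A]
  {M : CAMDP S A} {y i : S} {a₀ a : A} {p δ ε ζ : ℝ}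

lemma gain_ofDet_of_law {ρ : S → A → ℝ} (hM : ∀ s a, (M.P s a).1 = lawFun y a₀ ρ s a)
    (hq : ∀ b, ρ y b = p) (hp : 0 < p) (fy fr fh : ℝ) :
    M.gain (triReward y a₀ fy fr fh) (Policy.ofDet fun _ => a₀) = fr := by
  obtain ⟨m, F, -, -, h2, h3, h4⟩ := exists_balance hM hq (Policy.ofDet fun _ => a₀)
  simp only [exitProb_ofDet, if_true, mul_zero, Finset.sum_const_zero, mul_eq_zero, hp.ne',
    false_or] at h2
  have hW : ∀ s : S, ((Policy.ofDet fun _ => a₀ : Policy S A) s).1 a₀ = 1 := fun s => by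
    simp [Policy.ofDet]
  simp only [hW, sub_self, mul_zero, Finset.sum_const_zero, h2, zero_add] at h3 h4
  rw [h4, h3]
  ring

/-- Some policy spends its time on the perturbed pair and on `a₀` in a prescribed ratio. -/
lemma exists_policy_of_ratio (hS : 1 < Fintype.card S)
    (hM : ∀ s b, (M.P s b).1 = lawFun y a₀ (bump i a p (p * (1 + δ))) s b)
    (hi : i ≠ y) (ha : a ≠ a₀) (hp : 0 < p) {R : ℝ}
    (hR : ((Fintype.card S : ℝ) - 2) * (p * (1 + δ)) ≤ R) :
    ∃ (π : Policy S A) (X : ℝ), X * (2 + δ + R) = 1 ∧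
      ∀ fy fr fh, M.gain (triReward y a₀ fy fr fh) π = X * ((1 + δ) * fy + R * fr + fh) := by
  have hS' : (1 : ℝ) < Fintype.card S := by exact_mod_cast hS
  have hn : 0 < (Fintype.card S : ℝ) - 1 := by linarith
  -- The solution t of (S−2)(t + p(1+δ)) + t = R, the ratio achieved by `mixPolicy`.
  have ht : 0 ≤ (R - ((Fintype.card S : ℝ) - 2) * (p * (1 + δ))) / ((Fintype.card S : ℝ) - 1) :=
    div_nonneg (by linarith) hn.le
  obtain ⟨X, R', hR', h1, h2⟩ := exists_frequencies_mixPolicy hM hi ha hp ht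
  have : R' = R := by
    have h3 := div_mul_cancel₀ (R - ((Fintype.card S : ℝ) - 2) * (p * (1 + δ))) hn.ne'
    rw [hR']
    linear_combination h3
  rw [this] at h1 h2
  exact ⟨_, X, h1, h2⟩

omit [DecidableEq A] in
lemma le_optValue (hr : ∀ s a, M.r s a ≤ 1) {π : Policy S A} (hπ : M.b ≤ M.gain M.c π) :
    M.gain M.r π ≤ M.optValue :=
  le_csSup ⟨1, by rintro x ⟨π', -, rfl⟩; exact M.gain_le_one hr π'⟩ ⟨π, hπ, rfl⟩

omit [DecidableEq A] in
lemma slater_eq_of_isGreatest {v : ℝ} (h : ∀ π, M.gain M.c π ≤ v) {π : Policy S A}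
    (hπ : M.gain M.c π = v) : M.slater = v - M.b := by
  have : Nonempty (Policy S A) := ⟨π⟩
  rw [CAMDP.slater]
  congr 1
  exact le_antisymm (ciSup_le h)
    (hπ.ge.trans (le_ciSup (f := fun π => M.gain M.c π) ⟨v, by rintro _ ⟨π', rfl⟩; exact h π'⟩ π))

/-- The constraint average is 1/2 + δX/2 + 2ζR. As δ ≤ 4ζ, the gain from the pair never beats that
from `a₀`, so always playing `a₀` is best. -/
lemma slater_of_small (hM : ∀ s b, (M.P s b).1 = lawFun y a₀ (bump i a p (p * (1 + δ))) s b)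
    (hi : i ≠ y) (ha : a ≠ a₀) (hp : 0 < p) (hp1 : p ≤ 1) (hδ : 0 ≤ δ) (hδ1 : δ ≤ 1 / 10)
    (hδζ : δ ≤ 4 * ζ) (hc : M.c = triReward y a₀ 1 (1 / 2 + 2 * ζ) 0) (hb : M.b = 1 / 2 + ζ) :
    M.slater = ζ := by
  have hq : ∀ b, bump i a p (p * (1 + δ)) y b = p := fun b => if_neg fun h => hi h.1.symm
  rw [slater_eq_of_isGreatest (v := 1 / 2 + 2 * ζ) (π := Policy.ofDet fun _ => a₀), hb]
  · ring
  · intro π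
    obtain ⟨X, H, R, hX, hXH, hR, hsum, hg, -⟩ := exists_frequencies hM hi ha hp hp1 hδ hδ1 π
    rw [hc, hg]
    have h1 : δ * X ≤ 4 * ζ * H := mul_le_mul hδζ hXH hX (by linarith)
    have h2 : 0 ≤ ζ * (δ * X) := mul_nonneg (by linarith) (mul_nonneg hδ hX)
    nlinarith
  · rw [hc]; exact gain_ofDet_of_law hM hq hp _ _ _

lemma slater_of_large (hM : ∀ s b, (M.P s b).1 = lawFun y a₀ (bump i a p (p * (1 + δ))) s b)
    (hi : i ≠ y) (ha : a ≠ a₀) (hp : 0 < p) (hp1 : p ≤ 1) (hδ : 0 ≤ δ) (hδ1 : δ ≤ 1 / 10)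
    (hc : M.c = triReward y a₀ 0 0 0) (hb : M.b = -ζ) :
    M.slater = ζ := by
  have h0 : ∀ π, M.gain M.c π = 0 := by
    intro π
    obtain ⟨X, H, R, -, -, -, -, hg, -⟩ := exists_frequencies hM hi ha hp hp1 hδ hδ1 π
    rw [hc, hg]; ring
  rw [slater_eq_of_isGreatest (fun π => (h0 π).le) (h0 (Policy.ofDet fun _ => a₀)), hb]
  ring

/-- Exact feasibility forces 1 − 2R ≤ 8εX, while near-optimality forces 1 − R ≥ 1/2 + 23ε/24.
Together they give X ≥ 23/96, whereas H is close to 1/4. -/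
lemma concentrated_of_small (hS : 1 < Fintype.card S)
    (hM : ∀ s b, (M.P s b).1 = lawFun y a₀ (bump i a p (p * (1 + δ))) s b)
    (hi : i ≠ y) (ha : a ≠ a₀) (hp : 0 < p) (hp1 : p ≤ 1) (hε : 0 < ε) (hε1 : ε ≤ 1 / 1600)
    (hζ : 0 < ζ) (hζ1 : ζ ≤ 1 / 4) (hδ : δ = 16 * ε * ζ)
    (hSp : ((Fintype.card S : ℝ) - 2) * (p * (1 + δ)) ≤ 1 / 8)
    (hr : M.r = triReward y a₀ 1 0 1)
    (hc : M.c = triReward y a₀ 1 (1 / 2 + 2 * ζ) 0) (hb : M.b = 1 / 2 + ζ)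
    {π : Policy S A} (hπ : M.IsNearOptimal (ε / 24) π) : π ∈ concentrated y a₀ p i a := by
  have hδ0 : 0 ≤ δ := by rw [hδ]; positivity
  have hδ4 : δ ≤ 4 * ε := by rw [hδ]; nlinarith
  have hδ1 : δ ≤ 1 / 10 := by linarith
  -- The ratio 2 + δ − δ/(2ζ) makes the constraint tight.
  obtain ⟨π', X, hX, hg⟩ := exists_policy_of_ratio hS hM hi ha hp (R := 2 + δ - 8 * ε)
    (by linarith)
  have hden : 0 < 2 + δ + (2 + δ - 8 * ε) := by linarith
  have hX0 : 0 < X := by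
    by_contra h
    nlinarith
  have hfeas : M.b ≤ M.gain M.c π' := by
    rw [hb, hc, hg]
    refine le_of_eq ?_
    rw [hδ] at hX ⊢
    linear_combination (-(1 / 2 + ζ)) * hX
  have hopt : 1 / 2 + ε ≤ M.gain M.r π' := by
    rw [hr, hg]
    have h1 : X * (2 + δ) = 1 / 2 + 4 * ε * X := by linear_combination (1 / 2) * hX
    have h2 : 1 / 4 ≤ X := by nlinarith
    nlinarith
  have hr1 : ∀ s a, M.r s a ≤ 1 := fun s a => by
    rw [hr, triReward]; split_ifs <;> norm_num
  have hle := le_optValue hr1 hfeas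
  obtain ⟨h1, h2⟩ := hπ
  obtain ⟨X', H, R, hX', hXH, hR, hsum, hg', hconc⟩ :=
    exists_frequencies hM hi ha hp hp1 hδ0 hδ1 π
  rw [hr, hg'] at h1
  rw [hb, hc, hg'] at h2
  have h3 : ζ * (1 - 2 * R) ≤ ζ * (8 * ε * X') := by
    have h4 : δ * X' = 16 * ε * ζ * X' := by rw [hδ]
    nlinarith
  have h5 : 1 - 2 * R ≤ 8 * ε * X' := le_of_mul_le_mul_left h3 hζ
  have h6 : ε * (23 / 12) ≤ ε * (8 * X') := by linarith
  have h7 : 23 / 12 ≤ 8 * X' := le_of_mul_le_mul_left h6 hε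
  have hδX : 0 ≤ δ * X' := mul_nonneg hδ0 hX'
  have hX1 : X' ≤ 1 / 2 := by linarith
  have h8 : ε * X' ≤ 1 / 1600 * (1 / 2) := mul_le_mul hε1 hX1 hX' (by norm_num)
  exact hconc (by linarith) (by linarith)

/-- The average reward is 1/2 + δX/2 with δ ≥ 4ε, so losing at most ε/24 costs at most 1/48 in X.
Some policy has X ≥ 9/20, while H ≤ 1/2. -/
lemma concentrated_of_large (hS : 1 < Fintype.card S)
    (hM : ∀ s b, (M.P s b).1 = lawFun y a₀ (bump i a p (p * (1 + δ))) s b)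
    (hi : i ≠ y) (ha : a ≠ a₀) (hp : 0 < p) (hp1 : p ≤ 1) (hε : 0 < ε) (hε1 : ε ≤ 1 / 1600)
    (hζ : 1 / 4 < ζ) (hζ1 : ζ ≤ 1) (hδ : δ = 16 * ε * ζ)
    (hSp : ((Fintype.card S : ℝ) - 2) * (p * (1 + δ)) ≤ 1 / 8)
    (hr : M.r = triReward y a₀ 1 (1 / 2) 0)
    (hc : M.c = triReward y a₀ 0 0 0) (hb : M.b = -ζ)
    {π : Policy S A} (hπ : M.IsNearOptimal (ε / 24) π) : π ∈ concentrated y a₀ p i a := by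
  have hδ4 : 4 * ε ≤ δ := by rw [hδ]; nlinarith
  have hδ16 : δ ≤ 16 * ε := by rw [hδ]; nlinarith
  have hδ0 : 0 < δ := by linarith
  have hδ1 : δ ≤ 1 / 10 := by linarith
  obtain ⟨π', X, hX, hg⟩ := exists_policy_of_ratio hS hM hi ha hp hSp
  have hX0 : 9 / 20 ≤ X := by
    by_contra h
    nlinarith
  have hfeas : M.b ≤ M.gain M.c π' := by
    rw [hb, hc, hg]; linarith
  have hopt : M.gain M.r π' = 1 / 2 + δ * X / 2 := by
    rw [hr, hg]; linear_combination (1 / 2) * hX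
  have hr1 : ∀ s a, M.r s a ≤ 1 := fun s a => by
    rw [hr, triReward]; split_ifs <;> norm_num
  have hle := le_optValue hr1 hfeas
  obtain ⟨h1, -⟩ := hπ
  obtain ⟨X', H, R, hX', hXH, hR, hsum, hg', hconc⟩ :=
    exists_frequencies hM hi ha hp hp1 hδ0.le hδ1 π
  rw [hr, hg'] at h1
  have hδX : 0 ≤ δ * X' := mul_nonneg hδ0.le hX'
  have h3 : δ * (X - 1 / 48) ≤ δ * X' := by linarith
  have h4 := le_of_mul_le_mul_left h3 hδ0
  exact hconc (by linarith) (by linarith)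

end NearOptimal

/-! ### Information cost of a perturbation and summation over pairs. -/

section Information

/-- θ is one plus the χ²-divergence of Bernoulli(p) from Bernoulli(p(1+δ)), and `q` is the parameter
of the normalized density P₀²/P₁. Since this is again a probability law, the second moment of the
likelihood ratio turns into the total mass of a third sampling process. -/
lemma exists_tilt {p δ : ℝ} (hp : 0 < p) (hp1 : p ≤ 1 / 4) (hδ : 0 ≤ δ) (hδ1 : δ ≤ 1 / 10) :
    ∃ θ q : ℝ, 1 ≤ θ ∧ θ ≤ 1 + 2 * (p * δ ^ 2) ∧ q ∈ Set.Icc (0 : ℝ) 1 ∧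
      p ^ 2 = θ * (q * (p * (1 + δ))) ∧ (1 - p) ^ 2 = θ * ((1 - q) * (1 - p * (1 + δ))) := by
  have hd : 0 < 1 + δ := by linarith
  have h1 : 1 / 2 ≤ 1 - p * (1 + δ) := by nlinarith
  have h1' : 0 < 1 - p * (1 + δ) := by linarith
  have hz : 0 ≤ p * δ ^ 2 / ((1 + δ) * (1 - p * (1 + δ))) := by positivity
  set θ := 1 + p * δ ^ 2 / ((1 + δ) * (1 - p * (1 + δ))) with hθ
  have hθ1 : 1 ≤ θ := by linarith
  have hθ0 : 0 < θ := by linarith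
  have e1 : θ * ((1 + δ) * (1 - p * (1 + δ))) = (1 + δ) * (1 - p * (1 + δ)) + p * δ ^ 2 := by
    rw [hθ]; field_simp
  have e2 : p / (θ * (1 + δ)) * (θ * (1 + δ)) = p := div_mul_cancel₀ _ (by positivity)
  refine ⟨θ, p / (θ * (1 + δ)), hθ1, ?_, ⟨by positivity, ?_⟩, ?_, ?_⟩
  · have : p * δ ^ 2 / ((1 + δ) * (1 - p * (1 + δ))) ≤ 2 * (p * δ ^ 2) := by
      rw [div_le_iff₀ (by positivity)]
      have h2 : 1 / 2 ≤ (1 + δ) * (1 - p * (1 + δ)) := by nlinarith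
      have h3 : 0 ≤ p * δ ^ 2 := by positivity
      nlinarith
    linarith
  · rw [div_le_one (by positivity)]; nlinarith
  · linear_combination (-p) * e2
  · have e3 : θ * (1 - p * (1 + δ)) = (1 - p * (1 + δ)) + p * δ ^ 2 / (1 + δ) := by
      rw [hθ]; field_simp
    have e4 : θ * (p / (θ * (1 + δ))) = p / (1 + δ) := by field_simp
    have e5 : θ * ((1 - p / (θ * (1 + δ))) * (1 - p * (1 + δ))) =
        θ * (1 - p * (1 + δ)) - θ * (p / (θ * (1 + δ))) * (1 - p * (1 + δ)) := by ring
    rw [e5, e3, e4]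
    field_simp
    ring

variable {S A : Type} [Fintype S] [DecidableEq S] [DecidableEq A]

lemma lawFun_sq_le {y i : S} {a₀ a : A} {p p' q θ : ℝ} (hi : i ≠ y) (ha : a ≠ a₀)
    (h1 : p ^ 2 = θ * (q * p')) (h2 : (1 - p) ^ 2 = θ * ((1 - q) * (1 - p'))) (s : S) (b : A)
    (s' : S) :
    lawFun y a₀ (fun _ _ => p) s b s' ^ 2 ≤ (if (s, b) = (i, a) then θ else 1) *
      (lawFun y a₀ (bump i a p q) s b s' * lawFun y a₀ (bump i a p p') s b s') := by
  by_cases hx : s = i ∧ b = a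
  · obtain ⟨rfl, rfl⟩ := hx
    have hq : ∀ z, bump s b p z s b = z := fun z => if_pos ⟨rfl, rfl⟩
    simp only [lawFun, hq, if_neg hi, if_neg ha, if_true]
    by_cases hs : s' = s
    · have : s' ≠ y := fun h => hi (hs ▸ h)
      simp only [hs, hi, if_true, if_false, mul_one, mul_zero, add_zero]
      exact h2.le
    · by_cases hy : s' = y
      · simp only [hs, if_pos hy, if_false, mul_one, mul_zero, zero_add]
        exact h1.le
      · simp [hs, hy]
  · have hq : ∀ z, bump i a p z s b = p := fun z => if_neg hx
    have hx' : (s, b) ≠ (i, a) := fun h => hx (Prod.mk.inj h)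
    rw [if_neg hx', one_mul]
    simp only [lawFun, hq, pow_two, le_refl]

variable [Fintype A]

omit [DecidableEq S] [DecidableEq A] in
/-- Disjoint sets of policies, each of which is either returned with nonnegligible probability or
forces many samples at its own pair, force many samples in total. -/
lemma le_expectedSamples_of_disjoint (L : Sampler S A) (P : S → A → stdSimplex ℝ S)
    (I : Finset (S × A)) (E : S × A → Set (Policy S A)) (hE : ∀ x ∈ I, MeasurableSet (E x))
    (hdisj : ∀ x ∈ I, ∀ z ∈ I, x ≠ z → Disjoint (E x) (E z)) {K : ℕ} (hK : 0 < K)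
    (h : ∀ x ∈ I, ENNReal.ofReal (5 / 12) ≤ L.returnProb P (E x) + L.expectedVisits P x / K) :
    ENNReal.ofReal (K * (5 / 12 * I.card - 1)) ≤ L.expectedSamples P := by
  have hret : ∑ x ∈ I, L.returnProb P (E x) ≤ 1 := by
    refine le_trans ?_ (L.stopSum_one_le P)
    simp only [Sampler.returnProb_eq_stopSum, Sampler.stopSum]
    rw [← Summable.tsum_finsetSum fun _ _ => ENNReal.summable]
    refine ENNReal.tsum_le_tsum fun h => ?_
    rw [← Finset.mul_sum]
    gcongr
    refine (MeasureTheory.sum_measure_le_measure_univ (fun x hx => (hE x hx).nullMeasurableSet)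
      fun x hx z hz hxz => (hdisj x hx z hz hxz).aedisjoint).trans ?_
    simp
  have hvis : ∑ x ∈ I, L.expectedVisits P x / K ≤ L.expectedSamples P / K := by
    rw [L.expectedSamples_eq_sum P]
    simp only [div_eq_mul_inv, ← Finset.sum_mul]
    gcongr
    exact Finset.subset_univ I
  have hsum := Finset.sum_le_sum h
  rw [Finset.sum_add_distrib, Finset.sum_const, nsmul_eq_mul] at hsum
  have h1 : ENNReal.ofReal (5 / 12 * I.card) ≤ 1 + L.expectedSamples P / K := by
    rw [mul_comm, ENNReal.ofReal_mul (by positivity), ENNReal.ofReal_natCast]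
    exact hsum.trans (add_le_add hret hvis)
  rw [ENNReal.ofReal_mul (by positivity), ENNReal.ofReal_natCast, mul_comm,
    ← ENNReal.le_div_iff_mul_le (Or.inl (by exact_mod_cast hK.ne')) (Or.inl (by simp)),
    ENNReal.ofReal_sub _ zero_le_one, ENNReal.ofReal_one, tsub_le_iff_left]
  exact h1

lemma pow_le_four_thirds {z θ : ℝ} (hθ0 : 0 ≤ θ) (hθ : θ ≤ 1 + 2 * z) {K : ℕ}
    (hK : K * (8 * z) ≤ 1) : θ ^ K ≤ 4 / 3 := by
  have h1 : θ ^ K ≤ Real.exp (1 / 4) := by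
    calc θ ^ K ≤ Real.exp (2 * z) ^ K :=
          pow_le_pow_left₀ hθ0 (hθ.trans (by linarith [Real.add_one_le_exp (2 * z)])) K
      _ = Real.exp (K * (2 * z)) := (Real.exp_nat_mul _ _).symm
      _ ≤ Real.exp (1 / 4) := Real.exp_le_exp.2 (by linarith)
  -- exp(−1/4) ≥ 3/4 is the same as exp(1/4) ≤ 4/3.
  have h2 := Real.add_one_le_exp (-(1 / 4) : ℝ)
  rw [Real.exp_neg] at h2
  have h3 := Real.exp_pos (1 / 4)
  have h4 : Real.exp (1 / 4) * (Real.exp (1 / 4))⁻¹ = 1 := mul_inv_cancel₀ h3.ne'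
  nlinarith

end Information

/-! ### Choice of parameters and the lower bound. -/

section LowerBound

variable {S A : Type} [Fintype S] [DecidableEq S] [DecidableEq A] [Fintype A]

omit [Fintype S] [Fintype A] in
lemma triReward_mem {y : S} {a₀ : A} {fy fr fh : ℝ} (hy : fy ∈ Set.Icc (0 : ℝ) 1)
    (hr : fr ∈ Set.Icc (0 : ℝ) 1) (hh : fh ∈ Set.Icc (0 : ℝ) 1) (s : S) (a : A) :
    triReward y a₀ fy fr fh s a ∈ Set.Icc (0 : ℝ) 1 := by
  unfold triReward; split_ifs <;> assumption

/-- The known part of the hard instances. -/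
lemma exists_hard_task (hS : 1 < Fintype.card S) (y : S) (a₀ : A) {p ε ζ : ℝ} (hp : 0 < p)
    (hp1 : p ≤ 1) (hε : 0 < ε) (hε1 : ε ≤ 1 / 1600) (hζ : 0 < ζ) (hζ1 : ζ ≤ 1)
    (hSp : ((Fintype.card S : ℝ) - 2) * (p * (1 + 16 * ε * ζ)) ≤ 1 / 8) :
    ∃ T : Task S A,
      (∃ fy ∈ Set.Icc (0 : ℝ) 1, ∃ fr ∈ Set.Icc (0 : ℝ) 1, ∃ fh ∈ Set.Icc (0 : ℝ) 1,
        T.r = triReward y a₀ fy fr fh) ∧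
      (∃ fy ∈ Set.Icc (0 : ℝ) 1, ∃ fr ∈ Set.Icc (0 : ℝ) 1, ∃ fh ∈ Set.Icc (0 : ℝ) 1,
        T.c = triReward y a₀ fy fr fh) ∧
      ∀ (M : CAMDP S A) (i : S) (a : A) (δ : ℝ), M.toTask = T →
        (∀ s b, (M.P s b).1 = lawFun y a₀ (bump i a p (p * (1 + δ))) s b) → i ≠ y → a ≠ a₀ →
        0 ≤ δ → δ ≤ 16 * ε * ζ →
        M.slater = ζ ∧ (δ = 16 * ε * ζ → ∀ π, M.IsNearOptimal (ε / 24) π →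
          π ∈ concentrated y a₀ p i a) := by
  have m0 : (0 : ℝ) ∈ Set.Icc (0 : ℝ) 1 := by simp
  have m1 : (1 : ℝ) ∈ Set.Icc (0 : ℝ) 1 := by simp
  have m2 : (1 / 2 : ℝ) ∈ Set.Icc (0 : ℝ) 1 := by norm_num
  have hεζ : 16 * ε * ζ ≤ 1 / 10 := by nlinarith
  have hεζ' : 16 * ε * ζ ≤ 4 * ζ := by nlinarith
  -- The constraint reward 1/2 + 2ζ stays in [0,1] only for ζ ≤ 1/4. Above that, ζ is of constant
  -- order and an unconstrained instance suffices.
  by_cases hz : ζ ≤ 1 / 4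
  · have m3 : 1 / 2 + 2 * ζ ∈ Set.Icc (0 : ℝ) 1 := ⟨by linarith, by linarith⟩
    refine ⟨{ r := triReward y a₀ 1 0 1, c := triReward y a₀ 1 (1 / 2 + 2 * ζ) 0,
              b := 1 / 2 + ζ, init := ⟨_, single_mem_stdSimplex ℝ y⟩,
              r_mem := triReward_mem m1 m0 m1, c_mem := triReward_mem m1 m3 m0 },
      ⟨1, m1, 0, m0, 1, m1, rfl⟩, ⟨1, m1, _, m3, 0, m0, rfl⟩, ?_⟩
    intro M i a δ hMT hM hi ha hδ hδ1
    have hr : M.r = triReward y a₀ 1 0 1 := by rw [hMT]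
    have hc : M.c = triReward y a₀ 1 (1 / 2 + 2 * ζ) 0 := by rw [hMT]
    have hb : M.b = 1 / 2 + ζ := by rw [hMT]
    refine ⟨slater_of_small hM hi ha hp hp1 hδ (by linarith) (by linarith) hc hb, ?_⟩
    intro hδe π hπ
    exact concentrated_of_small hS hM hi ha hp hp1 hε hε1 hζ hz hδe (by rw [hδe]; exact hSp)
      hr hc hb hπ
  · push Not at hz
    refine ⟨{ r := triReward y a₀ 1 (1 / 2) 0, c := triReward y a₀ 0 0 0,
              b := -ζ, init := ⟨_, single_mem_stdSimplex ℝ y⟩,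
              r_mem := triReward_mem m1 m2 m0, c_mem := triReward_mem m0 m0 m0 },
      ⟨1, m1, _, m2, 0, m0, rfl⟩, ⟨0, m0, 0, m0, 0, m0, rfl⟩, ?_⟩
    intro M i a δ hMT hM hi ha hδ hδ1
    have hr : M.r = triReward y a₀ 1 (1 / 2) 0 := by rw [hMT]
    have hc : M.c = triReward y a₀ 0 0 0 := by rw [hMT]
    have hb : M.b = -ζ := by rw [hMT]
    refine ⟨slater_of_large hM hi ha hp hp1 hδ (by linarith) hc hb, ?_⟩
    intro hδe π hπ
    exact concentrated_of_large hS hM hi ha hp hp1 hε hε1 hz hζ1 hδe (by rw [hδe]; exact hSp)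
      hr hc hb hπ

omit [Fintype S] [Fintype A] in
lemma bump_mem {p p' : ℝ} (hp : p ∈ Set.Icc (0 : ℝ) 1) (hp' : p' ∈ Set.Icc (0 : ℝ) 1) (i : S)
    (a : A) (s : S) (b : A) : bump i a p p' s b ∈ Set.Icc (0 : ℝ) 1 := by
  unfold bump; split_ifs <;> assumption

/-- The unperturbed instance requires many samples of every successful algorithm. -/
theorem exists_hard_instance (hS : 4 ≤ Fintype.card S) (hA : 4 ≤ Fintype.card A) {ε ζ D : ℝ}
    (hε : 0 < ε) (hε1 : ε ≤ 1 / 1600) (hζ : 0 < ζ) (hζ1 : ζ ≤ 1)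
    (hD : 64 * (Fintype.card S : ℝ) ≤ D) (alg : Algorithm S A)
    (halg : ∀ M : CAMDP S A, InClass D ζ M →
      3 / 4 ≤ (alg M.toTask).returnProb M.P {π | M.IsNearOptimal (ε / 24) π}) :
    ∃ M : CAMDP S A, InClass D ζ M ∧ M.biasSpan ≤ 2 * D ∧
      ENNReal.ofReal (1 / 100000 * ((Fintype.card S : ℝ) * (Fintype.card A : ℝ) * D) /
        (ε ^ 2 * ζ ^ 2)) ≤ (alg M.toTask).expectedSamples M.P := by
  have hS1 : 1 < Fintype.card S := by omega
  have hSR : (4 : ℝ) ≤ Fintype.card S := by exact_mod_cast hS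
  have hAR : (4 : ℝ) ≤ Fintype.card A := by exact_mod_cast hA
  obtain ⟨y, i₀, hyi⟩ := Fintype.one_lt_card_iff.1 hS1
  obtain ⟨a₀, a₁, haa⟩ := Fintype.one_lt_card_iff.1 (by omega : 1 < Fintype.card A)
  have hD0 : 0 < D := by linarith
  -- Then S − 1 + 1/p = S − 1 + D/4 ≤ D, and pS ≤ 1/16 keeps the forced time on `a₀` small.
  obtain ⟨p, hpD⟩ : ∃ p, p = 4 / D := ⟨_, rfl⟩
  obtain ⟨δ, hδ⟩ : ∃ δ, δ = 16 * ε * ζ := ⟨_, rfl⟩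
  have hp : 0 < p := by rw [hpD]; positivity
  have hpD' : p * D = 4 := by rw [hpD]; field_simp
  have hpS : p * Fintype.card S ≤ 1 / 16 := by
    have := mul_le_mul_of_nonneg_left hD hp.le
    linarith
  have hp4 : p ≤ 1 / 64 := by nlinarith
  have hδ0 : 0 < δ := by rw [hδ]; positivity
  have hδ1 : δ ≤ 1 / 100 := by rw [hδ]; nlinarith
  have hinvp : 1 / p = D / 4 := by rw [hpD]; field_simp
  obtain ⟨T, ⟨fy, hfy, fr, hfr, fh, hfh, hTr⟩, ⟨gy, hgy, gr, hgr, gh, hgh, hTc⟩, hT⟩ :=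
    exists_hard_task hS1 y a₀ hp (by linarith) hε hε1 hζ hζ1
      (by rw [← hδ]; nlinarith)
  have hmp : p ∈ Set.Icc (0 : ℝ) 1 := ⟨hp.le, by linarith⟩
  have hmp' : p * (1 + δ) ∈ Set.Icc (0 : ℝ) 1 := ⟨by positivity, by nlinarith⟩
  have hpp' : p ≤ p * (1 + δ) := by nlinarith
  have hdiam : (Fintype.card S : ℝ) - 1 + 1 / p ≤ D := by rw [hinvp]; linarith
  let M₁ : S × A → CAMDP S A := fun x =>
    { toTask := T, P := law hS1 y a₀ (bump x.1 x.2 p (p * (1 + δ))) (bump_mem hmp hmp' _ _) }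
  let M₀ : CAMDP S A := { toTask := T, P := law hS1 y a₀ (fun _ _ => p) fun _ _ => hmp }
  have hM₀ : ∀ s a, (M₀.P s a).1 = lawFun y a₀ (fun _ _ => p) s a := fun _ _ => rfl
  -- The unperturbed instance is the case δ = 0 of the perturbed ones, so its Slater constant comes
  -- from the same task.
  have hbump : bump i₀ a₁ p (p * (1 + 0)) = fun _ _ => p := by
    ext s a; simp [bump]
  have hclass₀ : InClass D ζ M₀ :=
    ⟨isCommunicating_of_law hS1 hM₀ hp (fun _ _ => le_rfl) haa.symm,
      (diameter_le_of_law hS1 hM₀ (fun _ => rfl) hp (fun _ _ => le_rfl) haa.symm).trans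
        (ENNReal.ofReal_le_ofReal hdiam),
      (hT M₀ i₀ a₁ 0 rfl (by rw [hbump]; exact hM₀) hyi.symm haa.symm le_rfl (by positivity)).1⟩
  refine ⟨M₀, hclass₀, ?_, ?_⟩
  · refine (biasSpan_le_of_law hS1 hM₀ hp hmp.2 hfy hfr hfh hgy hgr hgh hTr hTc).trans
      (le_of_eq ?_)
    have : 8 / p = 8 * (1 / p) := by ring
    rw [this, hinvp]; ring
  by_cases hfin : (alg T).expectedSamples M₀.P = ∞
  · change _ ≤ (alg T).expectedSamples M₀.P
    rw [hfin]; exact le_top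
  let I : Finset (S × A) := Finset.univ.erase y ×ˢ Finset.univ.erase a₀
  have hI : ∀ x ∈ I, x.1 ≠ y ∧ x.2 ≠ a₀ := by
    intro x hx
    simpa [I] using hx
  have hz0 : 0 < p * δ ^ 2 := by positivity
  have hzs : p * δ ^ 2 ≤ 1 / 64 := by nlinarith
  -- Since θ ≤ 1 + 2pδ², this many visits keep the power of θ below exp(1/4). The argument of the
  -- floor is at least 2, so rounding loses at most half.
  set K := ⌊1 / (8 * (p * δ ^ 2))⌋₊
  have hKle : K * (8 * (p * δ ^ 2)) ≤ 1 := by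
    have := Nat.floor_le (by positivity : 0 ≤ 1 / (8 * (p * δ ^ 2)))
    rwa [le_div_iff₀ (by positivity)] at this
  have hbig : 2 ≤ 1 / (8 * (p * δ ^ 2)) := by
    rw [le_div_iff₀ (by positivity)]; linarith
  have hKge : 1 / (16 * (p * δ ^ 2)) ≤ K := by
    have h1 := Nat.lt_floor_add_one (1 / (8 * (p * δ ^ 2)))
    have h2 : 1 / (8 * (p * δ ^ 2)) = 2 * (1 / (16 * (p * δ ^ 2))) := by
      field_simp; norm_num
    linarith
  have hK : 0 < K := Nat.floor_pos.2 (by linarith)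
  have hkey := le_expectedSamples_of_disjoint (alg T) M₀.P I
    (fun x => concentrated y a₀ p x.1 x.2)
    (fun x _ => measurableSet_concentrated y a₀ p x.1 x.2)
    (fun x hx z hz hxz => disjoint_concentrated hp hmp.2 (hI x hx).1 (hI z hz).1 (hI x hx).2
      (hI z hz).2 hxz) hK fun x hx => by
        obtain ⟨hx1, hx2⟩ := hI x hx
        have hM₁ : ∀ s b, ((M₁ x).P s b).1 =
            lawFun y a₀ (bump x.1 x.2 p (p * (1 + δ))) s b := fun _ _ => rfl
        have hq : ∀ b, bump x.1 x.2 p (p * (1 + δ)) y b = p :=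
          fun b => if_neg fun h => hx1 h.1.symm
        have hge : ∀ s b, p ≤ bump x.1 x.2 p (p * (1 + δ)) s b := by
          intro s b; unfold bump; split_ifs <;> linarith
        obtain ⟨hsl, hconc⟩ := hT (M₁ x) x.1 x.2 δ rfl hM₁ hx1 hx2 hδ0.le hδ.le
        have hclass : InClass D ζ (M₁ x) :=
          ⟨isCommunicating_of_law hS1 hM₁ hp hge haa.symm,
            (diameter_le_of_law hS1 hM₁ hq hp hge haa.symm).trans
              (ENNReal.ofReal_le_ofReal hdiam), hsl⟩
        obtain ⟨θ, q, hθ1, hθ2, hq01, e1, e2⟩ :=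
          exists_tilt hp (by linarith) hδ0.le (by linarith)
        refine (alg T).le_returnProb_add_expectedVisits (P₁ := (M₁ x).P)
          (P₂ := law hS1 y a₀ (bump x.1 x.2 p q) (bump_mem hmp hq01 _ _)) hθ1
          (fun s b s' => lawFun_sq_le hx1 hx2 e1 e2 s b s')
          (measurableSet_concentrated y a₀ p x.1 x.2) ?_ hfin hK
          (pow_le_four_thirds (by linarith) hθ2 hKle)
        refine (halg (M₁ x) hclass).trans ?_
        rw [Sampler.returnProb_eq_stopSum, Sampler.returnProb_eq_stopSum]
        exact Sampler.stopSum_mono _ _ fun h =>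
          MeasureTheory.measure_mono fun π hπ => hconc hδ π hπ
  refine le_trans (ENNReal.ofReal_le_ofReal ?_) hkey
  have hIcard : (I.card : ℝ) = ((Fintype.card S : ℝ) - 1) * ((Fintype.card A : ℝ) - 1) := by
    rw [Finset.card_product, Nat.cast_mul, card_erase_eq, card_erase_eq]
  have hSA : 9 / 16 * ((Fintype.card S : ℝ) * Fintype.card A) ≤ I.card := by
    have h1 : 3 / 4 * (Fintype.card S : ℝ) ≤ (Fintype.card S : ℝ) - 1 := by linarith
    have h2 : 3 / 4 * (Fintype.card A : ℝ) ≤ (Fintype.card A : ℝ) - 1 := by linarith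
    have := mul_le_mul h1 h2 (by positivity) (by linarith)
    rw [hIcard]; linarith
  have hI9 : 9 ≤ (I.card : ℝ) := by
    rw [hIcard]; nlinarith
  -- With at least nine pairs, the subtracted 1 is at most a ninth of their number, and 5/12 − 1/9 >
  -- 3/10.
  have hlow : 3 / 10 * (9 / 16 * ((Fintype.card S : ℝ) * Fintype.card A)) ≤
      5 / 12 * I.card - 1 := by linarith
  have hfinal := mul_le_mul hKge hlow (by positivity) (Nat.cast_nonneg K)
  refine le_trans ?_ hfinal
  have e : 1 / (16 * (p * δ ^ 2)) = D / (16384 * (ε ^ 2 * ζ ^ 2)) := by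
    rw [hpD, hδ]; field_simp; norm_num
  have e' : D / (16384 * (ε ^ 2 * ζ ^ 2)) *
      (3 / 10 * (9 / 16 * ((Fintype.card S : ℝ) * Fintype.card A))) =
      27 / 2621440 * ((Fintype.card S : ℝ) * Fintype.card A * D) / (ε ^ 2 * ζ ^ 2) := by
    field_simp; norm_num
  rw [e, e']
  refine div_le_div_of_nonneg_right (mul_le_mul_of_nonneg_right ?_ (by positivity)) (by positivity)
  norm_num

end LowerBound

end AvgCMDP

theorem mainTheorem4 :
    ∃ (ε₀ κ c₁ c₂ : ℝ) (S₀ A₀ : ℕ), 0 < ε₀ ∧ 0 < κ ∧ 0 ≤ c₁ ∧ 0 ≤ c₂ ∧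
      ∀ (S A : ℕ) (ε ζ D : ℝ), S₀ ≤ S → A₀ ≤ A → 0 < ε → ε ≤ ε₀ → 0 < ζ → ζ ≤ 1 →
        max (c₁ * (S : ℝ)) c₂ ≤ D →
        ∀ alg : AvgCMDP.Algorithm (Fin S) (Fin A),
          (∀ M : AvgCMDP.CAMDP (Fin S) (Fin A), AvgCMDP.InClass D ζ M →
            3 / 4 ≤ (alg M.toTask).returnProb M.P {π | M.IsNearOptimal (ε / 24) π}) →
          ∃ M : AvgCMDP.CAMDP (Fin S) (Fin A), AvgCMDP.InClass D ζ M ∧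
            ENNReal.ofReal (κ * ((S : ℝ) * (A : ℝ) * D) / (ε ^ 2 * ζ ^ 2)) ≤
              (alg M.toTask).expectedSamples M.P ∧
            ENNReal.ofReal (κ * ((S : ℝ) * (A : ℝ) * M.biasSpan) / (ε ^ 2 * ζ ^ 2)) ≤
              (alg M.toTask).expectedSamples M.P := by
  -- κ is half of 1/100000 because the bias span is bounded by 2D rather than D.
  refine ⟨1 / 1600, 1 / 200000, 64, 0, 4, 4, by norm_num, by norm_num, by norm_num, le_rfl, ?_⟩
  intro S A ε ζ D hS hA hε hε1 hζ hζ1 hD alg halg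
  have hD1 : 64 * (S : ℝ) ≤ D := (le_max_left _ _).trans hD
  have hD0 : 0 ≤ D := (le_max_right _ _).trans hD
  obtain ⟨M, hM, hspan, hle⟩ := AvgCMDP.exists_hard_instance (by simpa using hS)
    (by simpa using hA) hε hε1 hζ hζ1 (by simpa using hD1) alg halg
  simp only [Fintype.card_fin] at hle
  refine ⟨M, hM, (ENNReal.ofReal_le_ofReal ?_).trans hle, (ENNReal.ofReal_le_ofReal ?_).trans hle⟩
  · have h1 : 0 ≤ (S : ℝ) * A * D := by positivity
    refine div_le_div_of_nonneg_right ?_ (by positivity)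
    linarith
  · have h1 : (S : ℝ) * A * M.biasSpan ≤ S * A * (2 * D) :=
      mul_le_mul_of_nonneg_left hspan (by positivity)
    refine div_le_div_of_nonneg_right ?_ (by positivity)
    linarith
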